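/- Let $\Delta$ be a veering triangulation of a connected oriented 3-manifold with finitely many tetrahedra, that is, an oriented ideal triangulation with a transverse taut structure (each tetrahedron has exactly two dihedral angles labelled $\pi$, at opposite edges, and the others are labelled $0$; the angle sum around each edge is $2\pi$; the faces are cooriented so that at each $0$-labelled edge of a tetrahedron exactly one of the two adjacent faces is cooriented inwards) and a colouring of the edges by red and blue such that, looking at any tetrahedron with a $\pi$-labelled edge in front, the four outer $0$-labelled edges, starting from an end of the front edge and going counter-clockwise, are red, blue, red, blue. Let $N$ be the number of tetrahedra. At an (ideal) vertex $T$ of $\Delta$, consider the boundary triangulation of the link of $T$, whose vertices are the ends of edges of $\Delta$ at $T$ and inherit their colours, and whose edges inherit the coorientations of the faces, which we take to point upwards. The *ladderpole curves* at $T$ are the curves formed by the edges of the boundary triangulation whose two ends have the same colour; each vertex of the boundary triangulation lies on exactly one of them. They are red or blue, alternate in colour, and are cyclically ordered from left to right (seen from $T$); there are $2n_T$ of them for some $n_T\ge 1$, the *ladderpole multiplicity* of $T$. Let $\nu=\max_T n_T$. A *red edge sequence* of period $P\ge 1$ is a cyclic sequence $(e_i)_{i\in\mathbb Z/P}$ of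 red oriented edges of $\Delta$ with vertices $(T_i)$ such that $e_i$ goes from $T_{i-1}$ to $T_i$, together with, for each $i$, one of the following two cases, which holds at $i$: (1) the terminal end of $e_i$ and the initial end of $e_{i+1}$ lie on the same ladderpole curve at $T_i$; (2) the initial end of $e_{i+1}$ lies on the ladderpole curve two to the left of that of the terminal end of $e_i$ at $T_i$. (If $n_{T_i}=1$ both conditions hold, and the case is a choice.) Case (1) is required to occur for at least one $i$. In case (2) we say that the sequence crosses, at $T_i$, the blue ladderpole curve next on the left to the red one of the terminal end of $e_i$; the number of times the sequence crosses a blue ladderpole curve $l$ is the number of indices $i$ at which it crosses $l$. Let $d_1,\dots,d_M$ be a finite collection (repetitions allowed) of red oriented edges of $\Delta$ that is *admissible*: at each vertex of $\Delta$ the number of incoming $d_i$ equals the number of outgoing $d_i$. Then there are $k\ge 0$, red oriented edges $d'_1,\dots,d'_k$ and a red edge sequence $(e_1,\dots,e_{M+2k})$ that is a permutation of $(d_1,\dots,d_M,d'_1,\dots,d'_k,-d'_1,\dots,-d'_k)$, where $-d'$ is $d'$ with the reverse orientation. Moreover, for every choice of an integer $\alpha_T\ge 1$ for each vertex $T$,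 these can be chosen such that, for every vertex $T$, the minimum over the blue ladderpole curves $l$ at $T$ of the number of times the sequence crosses $l$ is equal to $\alpha_T$, and such that $$k\le\Bigl(\frac{\nu}{2}M+\max_T\alpha_T+1\Bigr)N+M.$$ -/

import Mathlib

/-- The two colours of the edges of a veering triangulation. -/
inductive EdgeColor : Type
  | red : EdgeColor
  | blue : EdgeColor

/-- An oriented edge of a single tetrahedron with vertices labelled by `Fin 4`: it goes from
the vertex `src` to the vertex `tgt` of the tetrahedron `tet`. -/
@[ext]
structure TetEdge (Tet : Type*) where
  tet : Tet
  src : Fin 4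
  tgt : Fin 4
  ne : src ≠ tgt

/-- The same edge of the tetrahedron with the opposite orientation. -/
def TetEdge.flip {Tet : Type*} (x : TetEdge Tet) : TetEdge Tet :=
  ⟨x.tet, x.tgt, x.src, x.ne.symm⟩

/-- An ideal triangulation of an oriented 3-manifold, given by its set `Tet` of tetrahedra and its
face pairings. The vertices of each tetrahedron are labelled by `Fin 4`, so that the labelling is
positively oriented: seen from vertex `0`, the vertices `1, 2, 3` appear in clockwise order (and
likewise for every even relabelling). The face `f` of a tetrahedron is the one opposite to
its vertex `f`. The face `f` of `t` is glued to the face `glueMap t f f` of `glueTet t f`; a vertex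
`v ≠ f` of this face is glued to the vertex `glueMap t f v`, and the opposite vertices of the two
faces correspond under `glueMap t f`. -/
structure IdealTriangulation (Tet : Type*) where
  glueTet : Tet → Fin 4 → Tet
  glueMap : Tet → Fin 4 → Equiv.Perm (Fin 4)
  /-- Gluing back along the paired face is the inverse gluing. -/
  glueTet_glue : ∀ t f, glueTet (glueTet t f) (glueMap t f f) = t
  glueMap_glue : ∀ t f, glueMap (glueTet t f) (glueMap t f f) = (glueMap t f)⁻¹
  /-- No face is glued to itself. -/
  glue_ne_self : ∀ t f, ¬ (glueTet t f = t ∧ glueMap t f f = f)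
  /-- The gluings are compatible with the orientations of the tetrahedra. -/
  sign_glueMap : ∀ t f, Equiv.Perm.sign (glueMap t f) = -1

namespace IdealTriangulation

variable {Tet : Type*} (D : IdealTriangulation Tet)

/-- The triangulated manifold is connected: any two tetrahedra are joined by a chain of gluings. -/
def Connected : Prop :=
  ∀ s t : Tet, Relation.EqvGen (fun x y : Tet => ∃ f, y = D.glueTet x f) s t

/-- The vertices `x = (t, v)` and `y` of tetrahedra are identified by the gluing of some face of `t`
that contains `v`. -/
def VertexGlued (x y : Tet × Fin 4) : Prop :=
  ∃ f, f ≠ x.2 ∧ y = (D.glueTet x.1 f, D.glueMap x.1 f x.2)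

/-- The (ideal) vertices of the triangulation. -/
def Vertex : Type _ := Quot D.VertexGlued

/-- The oriented edges `x` and `y` of tetrahedra are identified by the gluing of some face of
`x.tet` that contains the edge. -/
def EdgeGlued (x y : TetEdge Tet) : Prop :=
  ∃ f, f ≠ x.src ∧ f ≠ x.tgt ∧
    y = ⟨D.glueTet x.tet f, D.glueMap x.tet f x.src, D.glueMap x.tet f x.tgt,
      (D.glueMap x.tet f).injective.ne x.ne⟩

/-- The oriented edges of the triangulation. -/
def OrientedEdge : Type _ := Quot D.EdgeGlued

/-- The oriented edge of the triangulation given by the edge from `a` to `b` in the tetrahedron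
`t`. -/
def edge (t : Tet) (a b : Fin 4) (h : a ≠ b) : D.OrientedEdge :=
  Quot.mk D.EdgeGlued ⟨t, a, b, h⟩

/-- The edge from the vertex `σ i` to the vertex `σ j` in `t`, for a labelling `σ` of the vertices
of `t`. -/
def edgeAt (t : Tet) (σ : Equiv.Perm (Fin 4)) (i j : Fin 4) (h : i ≠ j := by decide) :
    D.OrientedEdge :=
  D.edge t (σ i) (σ j) (σ.injective.ne h)

variable {D}

/-- The edge with the opposite orientation. -/
def OrientedEdge.rev : D.OrientedEdge → D.OrientedEdge :=
  Quot.map TetEdge.flip (by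
    rintro x y ⟨f, hs, ht, rfl⟩
    exact ⟨f, ht, hs, rfl⟩)

/-- The vertex from which an oriented edge starts. -/
def OrientedEdge.source : D.OrientedEdge → D.Vertex :=
  Quot.lift (fun x => Quot.mk D.VertexGlued (x.tet, x.src)) (by
    rintro x y ⟨f, hs, ht, rfl⟩
    exact Quot.sound ⟨f, hs, rfl⟩)

/-- The vertex at which an oriented edge ends. -/
def OrientedEdge.target (e : D.OrientedEdge) : D.Vertex := e.rev.source

end IdealTriangulation

/-- A transverse taut ideal triangulation. -/
structure TransverseTautTriangulation (Tet : Type*) extends IdealTriangulation Tet where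
  /-- `IsPi t a b`: the dihedral angle of `t` at its edge between `a` and `b` is labelled `π`;
  the other dihedral angles are labelled `0`. -/
  IsPi : Tet → Fin 4 → Fin 4 → Prop
  /-- Exactly two dihedral angles of each tetrahedron are labelled `π`, and these are opposite. -/
  isPi_iff : ∀ t, ∃ σ : Equiv.Perm (Fin 4), ∀ a b,
    IsPi t a b ↔ s(a, b) = s(σ 0, σ 1) ∨ s(a, b) = s(σ 2, σ 3)
  /-- The angle sum around each edge is `2π`, that is, exactly two of the dihedral angles around it
  are labelled `π`. -/
  angle_sum : ∀ e : toIdealTriangulation.OrientedEdge,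
    Nat.card {x : TetEdge Tet //
      Quot.mk toIdealTriangulation.EdgeGlued x = e ∧ IsPi x.tet x.src x.tgt} = 2
  /-- The coorientation of the faces. `Out t f`: the coorientation of the face `f` of `t` points out
  of `t` (otherwise it points into `t`). -/
  Out : Tet → Fin 4 → Prop
  /-- A face is cooriented out of the tetrahedron on one side, and into the one on the other. -/
  out_glue : ∀ t f, Out (glueTet t f) (glueMap t f f) ↔ ¬ Out t f
  /-- At each `0`-labelled edge of a tetrahedron, exactly one of the two adjacent faces is
  cooriented inwards. -/
  out_iff : ∀ t (σ : Equiv.Perm (Fin 4)), ¬ IsPi t (σ 0) (σ 1) → (Out t (σ 2) ↔ ¬ Out t (σ 3))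

/-- A veering triangulation. -/
structure VeeringTriangulation (Tet : Type*) extends TransverseTautTriangulation Tet where
  color : toIdealTriangulation.OrientedEdge → EdgeColor
  /-- The colour belongs to the unoriented edge. -/
  color_rev : ∀ e, color e.rev = color e
  /-- If `σ` is a positively oriented labelling of the vertices of `t` and the edge from `σ 0`
  to `σ 1` is `π`-labelled, then, looking at `t` with this edge in front, the outer vertices are
  `σ 0, σ 2, σ 1, σ 3` in counter-clockwise order. -/
  veering : ∀ t (σ : Equiv.Perm (Fin 4)), Equiv.Perm.sign σ = 1 → IsPi t (σ 0) (σ 1) →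
    color (toIdealTriangulation.edgeAt t σ 0 2) = EdgeColor.red ∧
    color (toIdealTriangulation.edgeAt t σ 2 1) = EdgeColor.blue ∧
    color (toIdealTriangulation.edgeAt t σ 1 3) = EdgeColor.red ∧
    color (toIdealTriangulation.edgeAt t σ 3 0) = EdgeColor.blue

namespace VeeringTriangulation

variable {Tet : Type*} (D : VeeringTriangulation Tet)

/-- The vertices of `D`. -/
abbrev Vert : Type _ := D.toIdealTriangulation.Vertex

/-- The oriented edges of `D`. A vertex of the boundary triangulation at `T` is an end at `T` of an
edge; it is represented by this edge with the orientation that starts at this end. -/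
abbrev OEdge : Type _ := D.toIdealTriangulation.OrientedEdge

/-- The vertices `e` and `e'` of the boundary triangulation have the same colour, and are joined
by an edge of the boundary triangulation, which is the corner at `σ 0` of the face of `t` with
vertices `σ 0, σ 1, σ 2`. -/
def PoleStep (e e' : D.OEdge) : Prop :=
  ∃ (t : Tet) (σ : Equiv.Perm (Fin 4)),
    e = D.edgeAt t σ 0 1 ∧ e' = D.edgeAt t σ 0 2 ∧ D.color e = D.color e'

/-- The ladderpole curves at all vertices of `D`. The ladderpole curves at `T` partition the
vertices of the boundary triangulation at `T`. An edge of the boundary triangulation lies on a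
ladderpole curve if its ends have the same colour, and joins two neighbouring ladderpole curves
otherwise. So the ladderpole curves are the connected components of the graph formed by
the edges of the boundary triangulation with both ends of the same colour. -/
def Ladderpole : Type _ := Quot D.PoleStep

variable {D}

/-- The ladderpole curve determined by a vertex of the boundary triangulation. -/
def pole (e : D.OEdge) : D.Ladderpole := Quot.mk D.PoleStep e

/-- The vertex of `D` at which a ladderpole curve lies. -/
def Ladderpole.vertex : D.Ladderpole → D.Vert :=
  Quot.lift IdealTriangulation.OrientedEdge.source (by
    rintro e e' ⟨t, σ, rfl, rfl, -⟩
    rfl)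

/-- The colour of the vertices on a ladderpole curve. -/
def Ladderpole.color : D.Ladderpole → EdgeColor :=
  Quot.lift D.color (by
    rintro e e' ⟨t, σ, -, -, h⟩
    exact h)

/-- `e` and `e'` have distinct colours and are, respectively, the left and the right end of an edge
of the boundary triangulation, when its coorientation points upwards and one looks at it from the
vertex of `D` (that is, from the inside of its neighbourhood): for a positively oriented labelling
`σ` one sees `σ 1, σ 2, σ 3` in clockwise order from `σ 0`, and, as the face opposite to `σ 3` is
cooriented out of `t`, the third corner `σ 3` is below the edge from `σ 1` to `σ 2`. -/
def LeftRung (e e' : D.OEdge) : Prop :=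
  ∃ (t : Tet) (σ : Equiv.Perm (Fin 4)), Equiv.Perm.sign σ = 1 ∧ D.Out t (σ 3) ∧
    e = D.edgeAt t σ 0 1 ∧ e' = D.edgeAt t σ 0 2 ∧ D.color e ≠ D.color e'

/-- The ladderpole curve `l` is the one next to `l'` on the left. -/
def NextLeft (l l' : D.Ladderpole) : Prop :=
  ∃ e e' : D.OEdge, pole e = l ∧ pole e' = l' ∧ LeftRung e e'

/-- `l` is two ladderpole curves to the left of `l'`. -/
def TwoLeft (l l' : D.Ladderpole) : Prop :=
  ∃ m : D.Ladderpole, NextLeft l m ∧ NextLeft m l'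

variable (D)

/-- The ladderpole multiplicity of `T`: half of the number of ladderpole curves at `T`. -/
noncomputable def ladderpoleMultiplicity (T : D.Vert) : ℕ :=
  Nat.card {l : D.Ladderpole // l.vertex = T} / 2

/-- The maximum `ν` of the ladderpole multiplicities (for finite `Tet`). -/
noncomputable def maxLadderpoleMultiplicity : ℕ :=
  ⨆ T : D.Vert, D.ladderpoleMultiplicity T

/-- A red edge sequence of period `P`, indexed cyclically by `Fin P`, where `finRotate P` is the
cyclic successor. The edge `edge i` arrives at `vert i` through the end `(edge i).rev`. -/
structure RedEdgeSequence (P : ℕ) where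
  edge : Fin P → D.OEdge
  vert : Fin P → D.Vert
  /-- `cross i` says that the second of the two cases applies to `i`. If there is only one red
  ladderpole curve at `vert i`, then the conditions of both cases hold, and so this is a choice. -/
  cross : Fin P → Prop
  color_edge : ∀ i, D.color (edge i) = EdgeColor.red
  target_edge : ∀ i, (edge i).target = vert i
  source_edge : ∀ i, (edge (finRotate P i)).source = vert i
  same_of_not_cross : ∀ i, ¬ cross i → pole (edge (finRotate P i)) = pole (edge i).rev
  left_of_cross : ∀ i, cross i → TwoLeft (pole (edge (finRotate P i))) (pole (edge i).rev)
  exists_not_cross : ∃ i, ¬ cross i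

variable {D}

/-- The number of times a red edge sequence crosses the (blue) ladderpole curve `l`. -/
noncomputable def RedEdgeSequence.crossings {P : ℕ} (S : D.RedEdgeSequence P) (l : D.Ladderpole) :
    ℕ :=
  Nat.card {i : Fin P // S.cross i ∧ NextLeft l (pole (S.edge i).rev)}

/-- An admissible collection of red oriented edges (possibly with repetitions). -/
def RedAdmissible {M : ℕ} (d : Fin M → D.OEdge) : Prop :=
  (∀ i, D.color (d i) = EdgeColor.red) ∧
    ∀ T : D.Vert, Nat.card {i : Fin M // (d i).target = T} =
      Nat.card {i : Fin M // (d i).source = T}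

/-- `S` is an arrangement of the collection that consists of the `d i`, the `d' j` and the reverses
of the `d' j`. -/
def RedEdgeSequence.Arranges {M k P : ℕ} (S : D.RedEdgeSequence P)
    (d : Fin M → D.OEdge) (d' : Fin k → D.OEdge) : Prop :=
  (List.ofFn S.edge).Perm
    (List.ofFn d ++ List.ofFn d' ++ List.ofFn fun j => (d' j).rev)

end VeeringTriangulation

/-! A red edge sequence is an Eulerian circuit in disguise. The nodes are the red ladderpole curves;
an oriented edge runs from the curve of its initial end to that of its terminal end; on arriving at
a curve `r` one leaves from `r` itself or, after a crossing, from `leftRed r`, the red curve two to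
the left. If `x r` arrivals at `r` are to cross, then a matching of arrivals with departures exists
exactly when `x` satisfies a balance equation at every curve, and `x r` is at most the number of
arrivals.

The balance equation is solved as a flow. Admissibility pairs the arrivals and departures of the `d
i` at each vertex, and a unit of flow is sent leftwards from each arriving curve to the paired
departing one (`exists_flow`). The pairs `d'`, `-d'` do not affect the balance. Shifting the flow by
a constant at each vertex makes its minimum there equal to `α T`.

The matching is a permutation of the edges, which must become a single cycle. Exchanging the
successors of two edges that arrive at the same curve, or whose successors depart from the same
curve, is allowed, and merges two cycles (`sameCycle_mul_swap`). With at least one crossing and one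
non-crossing arrival at each curve, a permutation with as many pairs in common cycles as possible
has one cycle, provided that the curves are connected by edges and left moves
(`exists_cyclic_arrangement`). For this, `d'` contains every red edge `c` times, where `c` exceeds
all `x r`; the red edges connect all vertices (`redJoined`), and there are at most `N` edges
(`exists_edge_of_tet`).

The geometric input is that the curves at a vertex are cyclically permuted by passing to the next
one on the left (`leftPole`, `sameCycle_leftPole`). Each boundary triangle meets one red and one
blue curve, and the coorientation of the face opposite to its corner tells which is on the left.
Triangles of one such type along a curve all lie in the same strip (`samePoles_of_pole_eq`), so each
curve has one neighbour on each side. -/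

/-! ### Merging and enumerating cycles of permutations -/

namespace Equiv.Perm

/-- Multiplication by a transposition merges the cycles of two points in different cycles. -/
theorem sameCycle_mul_swap {α : Type*} [Finite α] [DecidableEq α] {s : Perm α} {a b : α}
    (hab : ¬ s.SameCycle a b) :
    (s * swap a b).SameCycle a b ∧ ∀ x y, s.SameCycle x y → (s * swap a b).SameCycle x y := by
  have hne : ∀ x, x ≠ a → x ≠ b → (s * swap a b) x = s x := fun x ha hb => by
    rw [mul_apply, swap_apply_of_ne_of_ne ha hb]
  have ha : (s * swap a b) a = s b := by simp
  have hb : (s * swap a b) b = s a := by simp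
  have key : (s * swap a b).SameCycle a b := by
    -- From `a` the product goes to `s b` and then agrees with `s` while it avoids `a` and `b`. If
    -- it never met `b`, it would run through the whole `s`-cycle of `b`, which returns to `b`.
    by_contra hno
    have walk : ∀ n : ℕ, (s * swap a b).SameCycle a ((s ^ (n + 1)) b) := by
      intro n
      induction n with
      | zero => exact ⟨1, by simp⟩
      | succ n ih =>
        have h1 : (s ^ (n + 1)) b ≠ b := fun h => by
          rw [h] at ih
          exact hno ih
        have h2 : (s ^ (n + 1)) b ≠ a := fun h =>
          hab (SameCycle.symm ⟨(n + 1 : ℕ), by rw [zpow_natCast]; exact h⟩)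
        rw [pow_succ', mul_apply, ← hne _ h2 h1, sameCycle_apply_right]
        exact ih
    have := walk (orderOf s - 1)
    rw [Nat.sub_add_cancel (orderOf_pos s), pow_orderOf_eq_one] at this
    exact hno this
  refine ⟨key, ?_⟩
  have step : ∀ x, (s * swap a b).SameCycle x (s x) := by
    intro x
    by_cases hxa : x = a
    · subst hxa
      rw [← hb]
      exact sameCycle_apply_right.2 key
    by_cases hxb : x = b
    · subst hxb
      rw [← ha]
      exact sameCycle_apply_right.2 key.symm
    rw [← hne x hxa hxb]
    exact sameCycle_apply_right.2 (SameCycle.refl _ _)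
  intro x y h
  obtain ⟨n, rfl⟩ := h.exists_nat_pow_eq
  clear h
  induction n with
  | zero => exact SameCycle.refl _ _
  | succ n ih =>
    rw [pow_succ', mul_apply]
    exact ih.trans (step _)

/-- A permutation with a single cycle is the cyclic successor in some enumeration. -/
theorem exists_equiv_finRotate {α : Type*} [Finite α] {P : ℕ} (hP : Nat.card α = P) {s : Perm α}
    (hs : ∀ x y, s.SameCycle x y) : ∃ φ : Fin P ≃ α, ∀ i, φ (finRotate P i) = s (φ i) := by
  have := Fintype.ofFinite α
  rcases P with _ | n
  · have e : Fin 0 ≃ α := (Finite.equivFinOfCardEq hP).symm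
    exact ⟨e, fun i => i.elim0⟩
  · have hne : Nonempty α := (Nat.card_pos_iff.1 (by omega)).1
    obtain ⟨a⟩ := hne
    have hc : s.IsCycleOn (Finset.univ : Finset α) :=
      ⟨⟨fun _ _ => by simp, s.injective.injOn, fun x _ => ⟨s.symm x, by simp⟩⟩, fun x _ y _ => hs x y⟩
    have hcard : (Finset.univ : Finset α).card = n + 1 := by
      rw [Finset.card_univ, ← Nat.card_eq_fintype_card, hP]
    have hmod : ∀ k l : ℕ, (s ^ k) a = (s ^ l) a ↔ k ≡ l [MOD n + 1] := by
      intro k l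
      rw [hc.pow_apply_eq_pow_apply (Finset.mem_univ a), hcard]
    have hinj : Function.Injective fun i : Fin (n + 1) => (s ^ (i : ℕ)) a := by
      intro i j hij
      have := (hmod _ _).1 hij
      exact Fin.ext (Nat.ModEq.eq_of_lt_of_lt this i.2 j.2)
    have hbij := (Nat.bijective_iff_injective_and_card _).2 ⟨hinj, by rw [hP, Nat.card_fin]⟩
    refine ⟨Equiv.ofBijective _ hbij, fun i => ?_⟩
    change (s ^ ((finRotate (n + 1) i : Fin (n + 1)) : ℕ)) a = s ((s ^ (i : ℕ)) a)
    rw [← mul_apply, ← pow_succ', hmod, finRotate_apply, Fin.val_add]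
    refine (Nat.mod_modEq _ _).trans ?_
    rw [Fin.val_one']
    exact (Nat.ModEq.refl _).add (Nat.mod_modEq _ _)

end Equiv.Perm

/-! ### Finite families with prescribed fibres -/

/-- Two maps from a finite type with fibres of the same sizes differ by a permutation. -/
theorem exists_perm_of_card_fiber_eq {α β X : Type*} [Finite α] [Finite β] (u : α → X) (v : β → X)
    (h : ∀ r, Nat.card {a // u a = r} = Nat.card {b // v b = r}) :
    ∃ s : α ≃ β, ∀ a, v (s a) = u a := by
  have e : ∀ r, {a // u a = r} ≃ {b // v b = r} := fun r =>
    (Finite.equivFin _).trans ((finCongr (h r)).trans (Finite.equivFin _).symm)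
  refine ⟨(Equiv.sigmaFiberEquiv u).symm.trans
    ((Equiv.sigmaCongrRight e).trans (Equiv.sigmaFiberEquiv v)), fun a => ?_⟩
  exact (e (u a) ⟨a, rfl⟩).2

theorem Nat.card_subtype_or_disjoint {α : Type*} [Finite α] {p q : α → Prop}
    (h : ∀ a, p a → ¬ q a) :
    Nat.card {a // p a ∨ q a} = Nat.card {a // p a} + Nat.card {a // q a} := by
  classical
  have := Fintype.ofFinite α
  simp only [Nat.card_eq_fintype_card]
  exact Fintype.card_subtype_or_disjoint p q (by
    rw [Pi.disjoint_iff]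
    intro a
    rw [Prop.disjoint_iff]
    have := h a
    tauto)

theorem Nat.card_subtype_sum {α β : Type*} [Finite α] [Finite β] (p : α ⊕ β → Prop) :
    Nat.card {x // p x} = Nat.card {a // p (Sum.inl a)} + Nat.card {b // p (Sum.inr b)} := by
  rw [Nat.card_congr Equiv.subtypeSum, Nat.card_sum]

/-- In a finite family, `x r` members can be chosen from each fibre of `u` with at least `x r`
members. -/
theorem exists_choice_of_le_card_fiber {E X : Type*} [Finite E] (u : E → X) (x : X → ℕ)
    (h : ∀ r, x r ≤ Nat.card {e // u e = r}) :
    ∃ c : E → Prop, ∀ r, Nat.card {e // u e = r ∧ c e} = x r := by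
  have hex : ∀ r, ∃ s : Set E, s ⊆ {e | u e = r} ∧ s.ncard = x r := fun r =>
    Set.exists_subset_card_eq (h r)
  choose s hs hc using hex
  refine ⟨fun e => e ∈ s (u e), fun r => ?_⟩
  rw [← hc r, ← Nat.card_coe_set_eq]
  exact Nat.card_congr (Equiv.subtypeEquivRight fun e =>
    ⟨fun ⟨h1, h2⟩ => h1 ▸ h2, fun h => by
      have h1 : u e = r := hs r h
      exact ⟨h1, show e ∈ s (u e) by rwa [h1]⟩⟩)

/-! ### Cyclic arrangements with prescribed numbers of crossings -/

section Arrangement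

variable {E X : Type*} (inn out : E → X) (f : Equiv.Perm X) (x : X → ℕ)

/-- A permutation `s` of the edges and a choice of crossings such that each edge `e`, which arrives
at `inn e`, is followed by an edge that starts at `inn e`, or at `f (inn e)` in the case of a
crossing, with `x r` crossings from `r`. -/
def IsArrangement (s : Equiv.Perm E) (c : E → Prop) : Prop :=
  (∀ e, ¬ c e → out (s e) = inn e) ∧ (∀ e, c e → out (s e) = f (inn e)) ∧
    ∀ r, Nat.card {e // inn e = r ∧ c e} = x r

variable {inn out f x}

/-- Once the crossing arrivals are chosen, the edges to be continued from `f r` are the `x r` that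
cross from `r` and those that stay at `f r`. The balance equation says that there are as many of
these as departures from `f r`. -/
theorem exists_isArrangement [Finite E]
    (hbal : ∀ r, Nat.card {e // inn e = f r} + x r = Nat.card {e // out e = f r} + x (f r))
    (hx : ∀ r, x r ≤ Nat.card {e // inn e = r}) : ∃ s c, IsArrangement inn out f x s c := by
  classical
  obtain ⟨c, hc⟩ := exists_choice_of_le_card_fiber inn x hx
  obtain ⟨s, hs⟩ := exists_perm_of_card_fiber_eq (fun e => if c e then f (inn e) else inn e) out (by
    intro r
    obtain ⟨r, rfl⟩ := f.surjective r
    have h1 : Nat.card {e // inn e = f r} = Nat.card {e // (inn e = f r ∧ c e) ∨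
        (inn e = f r ∧ ¬ c e)} :=
      Nat.card_congr (Equiv.subtypeEquivRight fun e => by tauto)
    rw [Nat.card_subtype_or_disjoint (by tauto), hc] at h1
    have h2 : Nat.card {e // (if c e then f (inn e) else inn e) = f r} =
        Nat.card {e // (inn e = r ∧ c e) ∨ (inn e = f r ∧ ¬ c e)} :=
      Nat.card_congr (Equiv.subtypeEquivRight fun e => by by_cases h : c e <;> simp [h])
    rw [Nat.card_subtype_or_disjoint (by tauto), hc] at h2
    have := hbal r
    omega)
  exact ⟨s, c, fun e he => by simp [hs, he], fun e he => by simp [hs, he], hc⟩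

/-- The crossing decision is exchanged along with the successor, so the number of crossings from
each node is unchanged. -/
theorem IsArrangement.swap_inn [DecidableEq E] {s : Equiv.Perm E} {c : E → Prop}
    (h : IsArrangement inn out f x s c) {a b : E} (hab : inn a = inn b) :
    IsArrangement inn out f x (s * Equiv.swap a b) (fun e => c (Equiv.swap a b e)) := by
  have hi : ∀ e, inn (Equiv.swap a b e) = inn e := by
    intro e
    rw [Equiv.swap_apply_def]
    split_ifs with h1 h2
    · rw [h1, hab]
    · rw [h2, hab]
    · rfl
  refine ⟨fun e he => ?_, fun e he => ?_, fun r => ?_⟩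
  · rw [Equiv.Perm.mul_apply, h.1 _ he, hi]
  · rw [Equiv.Perm.mul_apply, h.2.1 _ he, hi]
  · rw [← h.2.2 r]
    exact Nat.card_congr ((Equiv.swap a b).subtypeEquiv fun e => by rw [hi])

/-- Here `a` and `b` may arrive at different nodes, so each keeps its own crossing decision. -/
theorem IsArrangement.swap_out [DecidableEq E] {s : Equiv.Perm E} {c : E → Prop}
    (h : IsArrangement inn out f x s c) {a b : E} (hab : out (s a) = out (s b)) :
    IsArrangement inn out f x (s * Equiv.swap a b) c := by
  have hi : ∀ e, out (s (Equiv.swap a b e)) = out (s e) := by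
    intro e
    rw [Equiv.swap_apply_def]
    split_ifs with h1 h2
    · rw [h1, hab]
    · rw [h2, hab]
    · rfl
  refine ⟨fun e he => ?_, fun e he => ?_, h.2.2⟩
  · rw [Equiv.Perm.mul_apply, hi, h.1 _ he]
  · rw [Equiv.Perm.mul_apply, hi, h.2.1 _ he]

/-- If the numbers of crossings match, and are positive and smaller than the numbers of arrivals,
then a connected family of edges can be arranged in a single cycle. -/
theorem exists_cyclic_arrangement [Finite E]
    (hbal : ∀ r, Nat.card {e // inn e = f r} + x r = Nat.card {e // out e = f r} + x (f r))
    (hpos : ∀ r, 0 < x r) (hlt : ∀ r, x r < Nat.card {e // inn e = r})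
    (hconn : ∀ r r', Relation.EqvGen (fun a b => b = f a ∨ ∃ e, a = out e ∧ b = inn e) r r') :
    ∃ s c, IsArrangement inn out f x s c ∧ ∀ e e', s.SameCycle e e' := by
  classical
  obtain ⟨s₀, c₀, h₀⟩ := exists_isArrangement hbal fun r => (hlt r).le
  let S : Set (Equiv.Perm E) := {s | ∃ c, IsArrangement inn out f x s c}
  -- Merging two cycles strictly increases this number, so at a maximum no allowed exchange joins
  -- distinct cycles.
  let μ : Equiv.Perm E → ℕ := fun s => Set.ncard {p : E × E | s.SameCycle p.1 p.2}
  obtain ⟨s, ⟨c, hs⟩, hmax⟩ := Set.exists_max_image S μ (Set.toFinite S) ⟨s₀, c₀, h₀⟩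
  have hsame : ∀ a b, (∃ c, IsArrangement inn out f x (s * Equiv.swap a b) c) →
      s.SameCycle a b := by
    intro a b h
    by_contra hab
    obtain ⟨h1, h2⟩ := Equiv.Perm.sameCycle_mul_swap hab
    refine (hmax _ h).not_gt (Set.ncard_lt_ncard ⟨fun p hp => h2 _ _ hp, fun hsub => ?_⟩
      (Set.toFinite _))
    exact hab (hsub (show (a, b) ∈ _ from h1))
  have hinn : ∀ a b, inn a = inn b → s.SameCycle a b := fun a b h =>
    hsame a b ⟨_, hs.swap_inn h⟩
  have hout : ∀ a b, out a = out b → s.SameCycle a b := fun a b h => by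
    have := hsame (s⁻¹ a) (s⁻¹ b) ⟨_, hs.swap_out (by simpa using h)⟩
    simpa using this
  have harr : ∀ r, ∃ e, inn e = r ∧ c e := fun r => by
    have : Nonempty {e // inn e = r ∧ c e} := by
      have h1 := hpos r
      rw [← hs.2.2 r] at h1
      exact (Nat.card_pos_iff.1 h1).1
    exact ⟨this.some.1, this.some.2⟩
  have hstay : ∀ r, ∃ e, inn e = r ∧ ¬ c e := fun r => by
    by_contra! h
    have h1 := hs.2.2 r
    have h2 := hlt r
    rw [Nat.card_congr (Equiv.subtypeEquivRight fun e => ⟨And.left, fun he => ⟨he, h e he⟩⟩)] at h1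
    omega
  -- A non-crossing arrival links the edges arriving at a node with those departing from it.
  have hinout : ∀ a b, inn a = out b → s.SameCycle a b := by
    intro a b h
    obtain ⟨e, he, hc⟩ := hstay (inn a)
    have h1 := hout (s e) b (by rw [hs.1 e hc, he, h])
    exact (hinn a e he.symm).trans (Equiv.Perm.sameCycle_apply_left.1 h1)
  have hrel : ∀ r r', Relation.EqvGen (fun a b => b = f a ∨ ∃ e, a = out e ∧ b = inn e) r r' →
      ∀ a b, inn a = r → inn b = r' → s.SameCycle a b := by
    intro r r' h
    induction h with
    | rel r r' h =>
      rintro a b rfl rfl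
      rcases h with h | ⟨e, h1, h2⟩
      · obtain ⟨e, he, hc⟩ := harr (inn a)
        have h1 := hinout b (s e) (by rw [hs.2.1 e hc, he, h])
        exact (hinn a e he.symm).trans (Equiv.Perm.sameCycle_apply_right.1 h1).symm
      · exact (hinout a e h1).trans (hinn e b h2.symm)
    | refl r => exact fun a b h h' => hinn a b (h.trans h'.symm)
    | symm r r' _ ih => exact fun a b h h' => (ih b a h' h).symm
    | trans r r' r'' _ _ ih ih' =>
      intro a b h h'
      obtain ⟨e, he, -⟩ := harr r'
      exact (ih a e h he).trans (ih' e b he h')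
  exact ⟨s, c, hs, fun e e' => hrel _ _ (hconn (inn e) (inn e')) e e' rfl rfl⟩

end Arrangement

/-! ### Flows on the cycles of a permutation -/

/-- The indicator function of the path from `p` to `q` along the cycle. -/
theorem Equiv.Perm.SameCycle.exists_path {X : Type*} [Finite X] [DecidableEq X] {f : Equiv.Perm X}
    {p q : X} (h : f.SameCycle p q) : ∃ χ : X → ℕ, (∀ r, χ r ≤ 1) ∧
      ∀ r, χ (f r) + (if q = f r then 1 else 0) = χ r + (if p = f r then 1 else 0) := by
  classical
  obtain ⟨j, hj, hmin⟩ : ∃ j : ℕ, (f ^ j) p = q ∧ ∀ i < j, (f ^ i) p ≠ q :=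
    ⟨Nat.find h.exists_nat_pow_eq, Nat.find_spec h.exists_nat_pow_eq,
      fun i hi => Nat.find_min h.exists_nat_pow_eq hi⟩
  -- The end point `q` is excluded: `χ r` counts the moves from `r` to `f r`. By minimality of `j`
  -- no point is repeated, since a repetition could be cut out.
  refine ⟨fun r => ∑ k ∈ Finset.range j, if (f ^ k) p = r then 1 else 0, fun r => ?_, fun r => ?_⟩
  · change ∑ k ∈ Finset.range j, _ ≤ 1
    rw [Finset.sum_boole, Nat.cast_id, Finset.card_le_one]
    have key : ∀ k l, k < l → l < j → (f ^ k) p = r → (f ^ l) p = r → False := by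
      intro k l hkl hl hk hr
      refine hmin (j - l + k) (by omega) ?_
      rw [pow_add, Equiv.Perm.mul_apply, hk, ← hr, ← Equiv.Perm.mul_apply, ← pow_add,
        Nat.sub_add_cancel hl.le, hj]
    intro k hk l hl
    simp only [Finset.mem_filter, Finset.mem_range] at hk hl
    by_contra hne
    rcases Nat.lt_or_gt_of_ne hne with h | h
    · exact key k l h hl.1 hk.2 hl.2
    · exact key l k h hk.1 hl.2 hk.2
  · have h1 : ∀ k, (if (f ^ k) p = r then 1 else 0) = if (f ^ (k + 1)) p = f r then 1 else 0 := by
      intro k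
      simp only [pow_succ', Equiv.Perm.mul_apply, f.injective.eq_iff]
    simp only [h1]
    rw [← hj, ← Finset.sum_range_succ, Finset.sum_range_succ' _ j]
    simp

/-- On the cycles of a permutation there is a flow with given inflows and outflows, which are
balanced on each cycle. -/
theorem exists_flow {X V : Type*} [Finite X] {M : ℕ} (f : Equiv.Perm X) (v : X → V)
    (hv : ∀ r r', v r = v r' → f.SameCycle r r') (p q : Fin M → X)
    (hpq : ∀ T, Nat.card {i // v (p i) = T} = Nat.card {i // v (q i) = T}) :
    ∃ h : X → ℕ, (∀ r, h r ≤ M) ∧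
      ∀ r, Nat.card {i // p i = f r} + h r = Nat.card {i // q i = f r} + h (f r) := by
  classical
  -- Pair each inflow with an outflow on the same cycle; the flow is the sum of the paths joining
  -- the pairs.
  obtain ⟨s, hs⟩ := exists_perm_of_card_fiber_eq (fun i => v (p i)) (fun i => v (q i)) hpq
  choose χ h1 h2 using fun i => (hv _ _ (hs i).symm : f.SameCycle (p i) (q (s i))).exists_path
  refine ⟨fun r => ∑ i, χ i r, fun r => ?_, fun r => ?_⟩
  · calc ∑ i, χ i r ≤ ∑ _i : Fin M, 1 := Finset.sum_le_sum fun i _ => h1 i r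
      _ = M := by simp
  · have h3 : Nat.card {i // q i = f r} = Nat.card {i // q (s i) = f r} :=
      Nat.card_congr (s.subtypeEquiv fun i => Iff.rfl).symm
    have h4 : ∀ u : Fin M → X, Nat.card {i // u i = f r} = ∑ i, if u i = f r then 1 else 0 := by
      intro u
      rw [Nat.card_eq_fintype_card, Fintype.card_subtype]
      simp
    rw [h3, h4, h4, ← Finset.sum_add_distrib, ← Finset.sum_add_distrib]
    refine Finset.sum_congr rfl fun i _ => ?_
    have := h2 i r
    omega

/-! ### Angles and coorientations in a single tetrahedron -/

namespace TransverseTautTriangulation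

variable {Tet : Type*} (D : TransverseTautTriangulation Tet)

open Equiv in
theorem isPi_iff_of_isPi {t : Tet} {σ : Perm (Fin 4)} (h : D.IsPi t (σ 0) (σ 1)) (a b : Fin 4) :
    D.IsPi t a b ↔ s(a, b) = s(σ 0, σ 1) ∨ s(a, b) = s(σ 2, σ 3) := by
  obtain ⟨τ, hτ⟩ := D.isPi_iff t
  obtain ⟨ρ, rfl⟩ : ∃ ρ, σ = τ * ρ := ⟨τ⁻¹ * σ, by simp⟩
  have key : ∀ ρ : Perm (Fin 4), (s(ρ 0, ρ 1) = s(0, 1) → s(ρ 2, ρ 3) = s(2, 3)) ∧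
      (s(ρ 0, ρ 1) = s(2, 3) → s(ρ 2, ρ 3) = s(0, 1)) := by decide
  have hm : ∀ i j k l : Fin 4, s(τ i, τ j) = s(τ k, τ l) ↔ s(i, j) = s(k, l) := by
    intro i j k l
    simp only [Sym2.eq_iff, τ.injective.eq_iff]
  have hm' : ∀ i j k l : Fin 4, s(i, j) = s(k, l) → s(τ i, τ j) = s(τ k, τ l) :=
    fun i j k l h => (hm i j k l).2 h
  rw [hτ]
  simp only [Perm.mul_apply] at h ⊢
  rw [hτ, hm, hm] at h
  rcases h with h | h
  · rw [hm' _ _ _ _ h, hm' _ _ _ _ ((key ρ).1 h)]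
  · rw [hm' _ _ _ _ h, hm' _ _ _ _ ((key ρ).2 h)]
    exact or_comm

theorem isPi_symm {t : Tet} {a b : Fin 4} (h : D.IsPi t a b) : D.IsPi t b a := by
  obtain ⟨τ, hτ⟩ := D.isPi_iff t
  rw [hτ] at h ⊢
  rwa [Sym2.eq_swap]

/-- The cyclic permutation of the labels `1, 2, 3`. -/
def rot : Equiv.Perm (Fin 4) := Equiv.swap 1 2 * Equiv.swap 2 3

theorem sign_mul_rot {σ : Equiv.Perm (Fin 4)} (h : Equiv.Perm.sign σ = 1) :
    Equiv.Perm.sign (σ * rot) = 1 := by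
  have : Equiv.Perm.sign rot = 1 := by decide
  rw [map_mul, h, this, one_mul]

theorem sign_mul_swap {σ : Equiv.Perm (Fin 4)} {i j : Fin 4} (hij : i ≠ j)
    (h : Equiv.Perm.sign σ = -1) : Equiv.Perm.sign (σ * Equiv.swap i j) = 1 := by
  rw [map_mul, h, Equiv.Perm.sign_swap hij]
  decide

/-- The coorientations of the faces around a `π`-labelled edge. -/
theorem out_of_isPi {t : Tet} {σ : Equiv.Perm (Fin 4)} (h : D.IsPi t (σ 0) (σ 1)) :
    (D.Out t (σ 0) ↔ D.Out t (σ 1)) ∧ (D.Out t (σ 2) ↔ D.Out t (σ 3)) ∧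
      (D.Out t (σ 0) ↔ ¬ D.Out t (σ 3)) := by
  have h02 : ¬ D.IsPi t (σ 0) (σ 2) := by
    simp [D.isPi_iff_of_isPi h, σ.injective.eq_iff]
  have h03 : ¬ D.IsPi t (σ 0) (σ 3) := by
    simp [D.isPi_iff_of_isPi h, σ.injective.eq_iff]
  have h12 : ¬ D.IsPi t (σ 1) (σ 2) := by
    simp [D.isPi_iff_of_isPi h, σ.injective.eq_iff]
  have a := D.out_iff t (σ * Equiv.swap 1 2) h02
  have b := D.out_iff t (σ * rot * rot) h03
  have c := D.out_iff t (σ * (Equiv.swap 0 1 * Equiv.swap 1 2)) h12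
  change D.Out t (σ 1) ↔ ¬ D.Out t (σ 3) at a
  change D.Out t (σ 1) ↔ ¬ D.Out t (σ 2) at b
  change D.Out t (σ 0) ↔ ¬ D.Out t (σ 3) at c
  tauto

/-- Each corner of a tetrahedron has a positively oriented labelling with the `π`-labelled edge at
the corner in front. -/
theorem exists_isPi (t : Tet) (v : Fin 4) : ∃ σ : Equiv.Perm (Fin 4),
    Equiv.Perm.sign σ = 1 ∧ σ 0 = v ∧ D.IsPi t (σ 0) (σ 1) := by
  suffices ∃ σ : Equiv.Perm (Fin 4), σ 0 = v ∧ D.IsPi t (σ 0) (σ 1) by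
    obtain ⟨σ, h0, h1⟩ := this
    rcases Int.units_eq_one_or (Equiv.Perm.sign σ) with h | h
    · exact ⟨σ, h, h0, h1⟩
    · exact ⟨σ * Equiv.swap 2 3, sign_mul_swap (by decide) h, h0, h1⟩
  obtain ⟨σ, hσ⟩ := D.isPi_iff t
  obtain ⟨i, rfl⟩ := σ.surjective v
  have h01 : D.IsPi t (σ 0) (σ 1) := (hσ _ _).2 (Or.inl rfl)
  have h23 : D.IsPi t (σ 2) (σ 3) := (hσ _ _).2 (Or.inr rfl)
  fin_cases i
  · exact ⟨σ, rfl, h01⟩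
  · exact ⟨σ * Equiv.swap 0 1, rfl, D.isPi_symm h01⟩
  · exact ⟨σ * (Equiv.swap 0 2 * Equiv.swap 1 3), rfl, h23⟩
  · exact ⟨σ * (Equiv.swap 0 3 * Equiv.swap 1 2), rfl, D.isPi_symm h23⟩

theorem eq_of_even : ∀ σ τ : Equiv.Perm (Fin 4), Equiv.Perm.sign σ = 1 → Equiv.Perm.sign τ = 1 →
    σ 0 = τ 0 → σ 1 = τ 1 → σ = τ := by
  intro σ τ hσ hτ h0 h1
  obtain ⟨ρ, rfl⟩ : ∃ ρ, τ = σ * ρ := ⟨σ⁻¹ * τ, by simp⟩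
  have key : ∀ ρ : Equiv.Perm (Fin 4), Equiv.Perm.sign ρ = 1 → 0 = ρ 0 → 1 = ρ 1 → ρ = 1 := by
    decide
  rw [map_mul, hσ, one_mul] at hτ
  rw [key ρ hτ (σ.injective h0) (σ.injective h1), mul_one]

theorem exists_even : ∀ a b : Fin 4, a ≠ b → ∃ σ : Equiv.Perm (Fin 4),
    Equiv.Perm.sign σ = 1 ∧ σ 0 = a ∧ σ 1 = b := by decide

/-- At each corner exactly one of the edges is `π`-labelled. -/
theorem isPi_corner (t : Tet) (σ : Equiv.Perm (Fin 4)) :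
    D.IsPi t (σ 0) (σ 1) ∨ D.IsPi t (σ 0) (σ 2) ∨ D.IsPi t (σ 0) (σ 3) := by
  obtain ⟨τ, -, h0, h1⟩ := D.exists_isPi t (σ 0)
  obtain ⟨i, hi⟩ := σ.surjective (τ 1)
  rw [← hi, h0] at h1
  fin_cases i
  · have : σ 0 = τ 1 := hi
    rw [← h0] at this
    exact absurd (τ.injective this) (by decide)
  · exact Or.inl h1
  · exact Or.inr (Or.inl h1)
  · exact Or.inr (Or.inr h1)

end TransverseTautTriangulation

/-! ### Rotation around an edge -/

namespace VeeringTriangulation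

open TransverseTautTriangulation

variable {Tet : Type*} (D : VeeringTriangulation Tet)

/-- A positively oriented labelling of the vertices of a tetrahedron; it is regarded as the edge
from `σ 0` to `σ 1`. -/
@[ext]
structure Flag (Tet : Type*) where
  tet : Tet
  σ : Equiv.Perm (Fin 4)
  even : Equiv.Perm.sign σ = 1

variable {D}

/-- The edge of the tetrahedron in front. -/
def Flag.tetEdge (s : Flag Tet) : TetEdge Tet := ⟨s.tet, s.σ 0, s.σ 1, s.σ.injective.ne (by decide)⟩

theorem Flag.tetEdge_bijective : Function.Bijective (Flag.tetEdge (Tet := Tet)) := by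
  constructor
  · rintro ⟨t, σ, hσ⟩ ⟨t', τ, hτ⟩ h
    simp only [Flag.tetEdge, TetEdge.mk.injEq] at h
    obtain ⟨rfl, h0, h1⟩ := h
    obtain rfl := eq_of_even _ _ hσ hτ h0 h1
    rfl
  · rintro ⟨t, a, b, h⟩
    obtain ⟨σ, hσ, rfl, rfl⟩ := exists_even a b h
    exact ⟨⟨t, σ, hσ⟩, rfl⟩

variable (D)

/-- The labelling of the neighbouring tetrahedron across the face opposite to `σ 3`, with the same
edge in front. -/
def next (s : Flag Tet) : Flag Tet where
  tet := D.glueTet s.tet (s.σ 3)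
  σ := D.glueMap s.tet (s.σ 3) * s.σ * Equiv.swap 2 3
  even := by
    rw [map_mul, map_mul, D.sign_glueMap, s.even, Equiv.Perm.sign_swap (by decide)]
    decide

/-- The labelling of the neighbouring tetrahedron across the face opposite to `σ 2`, with the same
edge in front. -/
def prev (s : Flag Tet) : Flag Tet where
  tet := D.glueTet s.tet (s.σ 2)
  σ := D.glueMap s.tet (s.σ 2) * s.σ * Equiv.swap 2 3
  even := by
    rw [map_mul, map_mul, D.sign_glueMap, s.even, Equiv.Perm.sign_swap (by decide)]
    decide

theorem prev_next (s : Flag Tet) : D.prev (D.next s) = s := by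
  have h2 : (D.next s).σ 2 = D.glueMap s.tet (s.σ 3) (s.σ 3) := rfl
  refine Flag.ext ?_ ?_
  · change D.glueTet (D.glueTet s.tet (s.σ 3)) ((D.next s).σ 2) = _
    rw [h2, D.glueTet_glue]
  · change D.glueMap (D.glueTet s.tet (s.σ 3)) ((D.next s).σ 2) * (D.next s).σ * _ = _
    rw [h2, D.glueMap_glue]
    simp [next, mul_assoc]

theorem next_prev (s : Flag Tet) : D.next (D.prev s) = s := by
  have h2 : (D.prev s).σ 3 = D.glueMap s.tet (s.σ 2) (s.σ 2) := rfl
  refine Flag.ext ?_ ?_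
  · change D.glueTet (D.glueTet s.tet (s.σ 2)) ((D.prev s).σ 3) = _
    rw [h2, D.glueTet_glue]
  · change D.glueMap (D.glueTet s.tet (s.σ 2)) ((D.prev s).σ 3) * (D.prev s).σ * _ = _
    rw [h2, D.glueMap_glue]
    simp [prev, mul_assoc]

/-- The rotation around the front edge. -/
def turn : Equiv.Perm (Flag Tet) := ⟨D.next, D.prev, D.prev_next, D.next_prev⟩

/-- The oriented edge of the triangulation in front. -/
def front (s : Flag Tet) : D.OEdge := Quot.mk _ s.tetEdge

theorem front_turn (s : Flag Tet) : D.front (D.turn s) = D.front s :=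
  (Quot.sound ⟨s.σ 3, s.σ.injective.ne (by decide), s.σ.injective.ne (by decide), rfl⟩ :
    D.front s = D.front (D.turn s)).symm

theorem front_eq_edgeAt (s : Flag Tet) : D.front s = D.edgeAt s.tet s.σ 0 1 := rfl

theorem front_surjective : Function.Surjective D.front := by
  intro e
  induction e using Quot.ind with
  | mk x =>
    obtain ⟨s, rfl⟩ := Flag.tetEdge_bijective.2 x
    exact ⟨s, rfl⟩

/-- The only faces of a tetrahedron that contain the front edge are those opposite to `σ 2` and `σ
3`, so each gluing of edges is a turn or its inverse. -/
theorem sameCycle_of_front_eq {s s' : Flag Tet} (h : D.front s = D.front s') :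
    D.turn.SameCycle s s' := by
  have key : ∀ x y : TetEdge Tet, Relation.EqvGen D.EdgeGlued x y → ∀ s s' : Flag Tet,
      s.tetEdge = x → s'.tetEdge = y → D.turn.SameCycle s s' := by
    intro x y hxy
    induction hxy with
    | rel x y h =>
      rintro s s' rfl rfl
      obtain ⟨f, h0, h1, h⟩ := h
      obtain ⟨i, rfl⟩ := s.σ.surjective f
      have h0' : i ≠ 0 := fun h => h0 (h ▸ rfl)
      have h1' : i ≠ 1 := fun h => h1 (h ▸ rfl)
      have : s' = D.turn s ∨ s' = D.turn⁻¹ s := by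
        have : i = 3 ∨ i = 2 := by omega
        rcases this with rfl | rfl
        · exact Or.inl (Flag.tetEdge_bijective.1 h)
        · exact Or.inr (Flag.tetEdge_bijective.1 h)
      rcases this with rfl | rfl
      · exact ⟨1, by simp⟩
      · exact ⟨-1, by simp⟩
    | refl x =>
      rintro s s' h h'
      rw [Flag.tetEdge_bijective.1 (h.trans h'.symm)]
    | symm x y _ ih => exact fun s s' h h' => (ih s' s h' h).symm
    | trans x y z _ _ ih ih' =>
      intro s s' h h'
      obtain ⟨r, rfl⟩ := Flag.tetEdge_bijective.2 y
      exact (ih s r h rfl).trans (ih' r s' rfl h')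
  exact key _ _ (Quot.eqvGen_exact h) _ _ rfl rfl

/-- The front edge is `π`-labelled. -/
def FrontPi (s : Flag Tet) : Prop := D.IsPi s.tet (s.σ 0) (s.σ 1)

theorem out_turn (s : Flag Tet) :
    D.Out (D.turn s).tet ((D.turn s).σ 2) ↔ ¬ D.Out s.tet (s.σ 3) :=
  D.out_glue s.tet (s.σ 3)

/-- During the rotation, the coorientation of the faces relative to the direction of rotation is
preserved across a `0`-angle and reversed across a `π`-angle. -/
theorem out_turn_of_not_frontPi {s : Flag Tet} (h : ¬ D.FrontPi (D.turn s)) :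
    D.Out (D.turn s).tet ((D.turn s).σ 3) ↔ D.Out s.tet (s.σ 3) := by
  have h1 := D.out_iff _ _ h
  have h2 := D.out_turn s
  tauto

theorem out_turn_of_frontPi {s : Flag Tet} (h : D.FrontPi (D.turn s)) :
    D.Out (D.turn s).tet ((D.turn s).σ 3) ↔ ¬ D.Out s.tet (s.σ 3) := by
  have h1 := D.out_of_isPi h
  have h2 := D.out_turn s
  tauto

instance [Finite Tet] : Finite (TetEdge Tet) :=
  Finite.of_injective (fun x : TetEdge Tet => (x.tet, x.src, x.tgt)) (by
    intro x y h
    simp only [Prod.mk.injEq] at h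
    exact TetEdge.ext h.1 h.2.1 h.2.2)

instance [Finite Tet] : Finite (Flag Tet) :=
  Finite.of_injective _ Flag.tetEdge_bijective.1

theorem card_frontPi (e : D.OEdge) : Nat.card {s : Flag Tet // D.front s = e ∧ D.FrontPi s} = 2 := by
  rw [← D.angle_sum e]
  exact Nat.card_congr ((Equiv.ofBijective _ Flag.tetEdge_bijective).subtypeEquiv fun s => Iff.rfl)

theorem exists_frontPi (e : D.OEdge) : ∃ s, D.front s = e ∧ D.FrontPi s := by
  have h := D.card_frontPi e
  have : Nonempty {s : Flag Tet // D.front s = e ∧ D.FrontPi s} := by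
    by_contra h'
    rw [not_nonempty_iff] at h'
    simp at h
  exact ⟨this.some.1, this.some.2⟩

variable [Finite Tet]

/-- Otherwise the relative coorientation would stay constant all the way round from `s` to its
predecessor, but passing through `s` reverses it. -/
theorem exists_frontPi_opposite {s : Flag Tet} (hs : D.FrontPi s) :
    ∃ r, D.front r = D.front s ∧ D.FrontPi r ∧
      (D.Out r.tet (r.σ 3) ↔ ¬ D.Out s.tet (s.σ 3)) := by
  by_contra! hno
  have key : ∀ n : ℕ, D.front ((D.turn ^ n) s) = D.front s ∧
      (D.Out ((D.turn ^ n) s).tet (((D.turn ^ n) s).σ 3) ↔ D.Out s.tet (s.σ 3)) := by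
    intro n
    induction n with
    | zero => simp
    | succ n ih =>
      rw [pow_succ', Equiv.Perm.mul_apply]
      have hf := (D.front_turn _).trans ih.1
      refine ⟨hf, ?_⟩
      by_cases hp : D.FrontPi (D.turn ((D.turn ^ n) s))
      · have := hno _ hf hp
        tauto
      · exact (D.out_turn_of_not_frontPi hp).trans ih.2
  obtain ⟨n, hn⟩ := (show D.turn.SameCycle s (D.turn⁻¹ s) from ⟨-1, by simp⟩).exists_nat_pow_eq
  have h1 := (key n).2
  rw [hn] at h1
  have h2 := D.out_turn_of_frontPi (s := D.turn⁻¹ s) (by simpa using hs)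
  rw [show D.turn (D.turn⁻¹ s) = s by simp] at h2
  tauto

/-- Two distinct such flags and the one opposite to them would be three `π`-angles around an edge.
-/
theorem frontPi_unique {s s' : Flag Tet} (hs : D.FrontPi s) (hs' : D.FrontPi s')
    (hf : D.front s = D.front s') (hu : D.Out s.tet (s.σ 3) ↔ D.Out s'.tet (s'.σ 3)) : s = s' := by
  by_contra hne
  obtain ⟨r, hr, hrp, hru⟩ := D.exists_frontPi_opposite hs
  have h1 : r ≠ s := by rintro rfl; tauto
  have h2 : r ≠ s' := by rintro rfl; tauto
  have hinj : Function.Injective (![⟨r, hr, hrp⟩, ⟨s, rfl, hs⟩, ⟨s', hf.symm, hs'⟩] :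
      Fin 3 → {x : Flag Tet // D.front x = D.front s ∧ D.FrontPi x}) := by
    intro i j hij
    fin_cases i <;> fin_cases j <;> simp_all [Subtype.ext_iff, eq_comm]
  have := Nat.card_le_card_of_injective _ hinj
  rw [D.card_frontPi] at this
  simp at this

theorem exists_frontPi_out (e : D.OEdge) :
    ∃ s, D.front s = e ∧ D.FrontPi s ∧ D.Out s.tet (s.σ 3) := by
  obtain ⟨s, rfl, hs⟩ := D.exists_frontPi e
  obtain ⟨r, hr, hrp, hru⟩ := D.exists_frontPi_opposite hs
  by_cases h : D.Out s.tet (s.σ 3)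
  · exact ⟨s, rfl, hs, h⟩
  · exact ⟨r, hr, hrp, hru.2 h⟩

theorem exists_frontPi_not_out (e : D.OEdge) :
    ∃ s, D.front s = e ∧ D.FrontPi s ∧ ¬ D.Out s.tet (s.σ 3) := by
  obtain ⟨s, rfl, hs, h⟩ := D.exists_frontPi_out e
  obtain ⟨r, hr, hrp, hru⟩ := D.exists_frontPi_opposite hs
  exact ⟨r, hr, hrp, by tauto⟩

end VeeringTriangulation

/-! ### Boundary triangles, their types, and the strips between ladderpole curves -/

theorem EdgeColor.eq_of_ne_of_ne {a b c : EdgeColor} (ha : a ≠ c) (hb : b ≠ c) : a = b := by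
  cases a <;> cases b <;> cases c <;> simp_all

theorem EdgeColor.ne_red {a : EdgeColor} : a ≠ red ↔ a = blue := by
  cases a <;> simp

/-- A relation that holds between consecutive points of the same type holds between all points of
the same type on a cycle, if the type changes at most once in each direction. -/
theorem Equiv.Perm.SameCycle.rel_of_type {α : Type*} [Finite α] {f : Equiv.Perm α}
    {S : α → α → Prop} (hS : Equivalence S) {T : α → Prop}
    (step : ∀ a, (T a ↔ T (f a)) → S a (f a))
    (uniq : ∀ a b, f.SameCycle a b → (T a ↔ T b) → ¬ (T a ↔ T (f a)) → ¬ (T b ↔ T (f b)) → a = b)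
    {a b : α} (h : f.SameCycle a b) (hT : T a ↔ T b) : S a b := by
  have key : ∀ a b, f.SameCycle a b → (T a ↔ T b) →
      S a b ∨ ∃ w, f.SameCycle a w ∧ S a w ∧ (T a ↔ T w) ∧ ¬ (T w ↔ T (f w)) := by
    intro a b h hT
    have walk : ∀ n : ℕ, (S a ((f ^ n) a) ∧ (T a ↔ T ((f ^ n) a))) ∨
        ∃ w, f.SameCycle a w ∧ S a w ∧ (T a ↔ T w) ∧ ¬ (T w ↔ T (f w)) := by
      intro n
      induction n with
      | zero => exact Or.inl ⟨hS.refl a, Iff.rfl⟩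
      | succ n ih =>
        rcases ih with ⟨h1, h2⟩ | h
        · by_cases hc : T ((f ^ n) a) ↔ T (f ((f ^ n) a))
          · rw [pow_succ', Equiv.Perm.mul_apply]
            exact Or.inl ⟨hS.trans h1 (step _ hc), h2.trans hc⟩
          · exact Or.inr ⟨_, ⟨n, by simp⟩, h1, h2, hc⟩
        · exact Or.inr h
    obtain ⟨n, rfl⟩ := h.exists_nat_pow_eq
    exact (walk n).imp_left And.left
  -- Walking from `a` either reaches `b` or leaves the type at some `w`; likewise from `b`.
  -- Uniqueness of the exit point makes both walks end at the same place.
  rcases key a b h hT with h1 | ⟨w, hw, hSw, hTw, hew⟩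
  · exact h1
  rcases key b a h.symm hT.symm with h2 | ⟨w', hw', hSw', hTw', hew'⟩
  · exact hS.symm h2
  obtain rfl := uniq w w' (hw.symm.trans (h.trans hw'))
    (hTw.symm.trans (hT.trans hTw')) hew hew'
  exact hS.trans hSw (hS.symm hSw')

namespace VeeringTriangulation

open TransverseTautTriangulation

variable {Tet : Type*} (D : VeeringTriangulation Tet)

/-- The corner of the tetrahedron at the source of the front edge. -/
def Flag.corner (s : Flag Tet) : Tet × Fin 4 := (s.tet, s.σ 0)

/-- The labelling at the same corner with the next edge in front. -/
def Flag.rot (s : Flag Tet) : Flag Tet :=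
  ⟨s.tet, s.σ * TransverseTautTriangulation.rot, sign_mul_rot s.even⟩

theorem Flag.rot_rot_rot (s : Flag Tet) : s.rot.rot.rot = s := by
  have : TransverseTautTriangulation.rot * TransverseTautTriangulation.rot *
    TransverseTautTriangulation.rot = 1 := by decide
  refine Flag.ext rfl ?_
  change s.σ * _ * _ * _ = s.σ
  rw [mul_assoc, mul_assoc, ← mul_assoc TransverseTautTriangulation.rot, this, mul_one]

theorem Flag.eq_of_corner_eq {s s' : Flag Tet} (h : s.corner = s'.corner) :
    s' = s ∨ s' = s.rot ∨ s' = s.rot.rot := by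
  obtain ⟨t, σ, hσ⟩ := s
  obtain ⟨t', τ, hτ⟩ := s'
  simp only [Flag.corner, Prod.mk.injEq] at h
  obtain ⟨rfl, h0⟩ := h
  obtain ⟨i, hi⟩ := σ.surjective (τ 1)
  have key : ∀ s : Flag Tet, s.tet = t → s.σ 0 = τ 0 → s.σ 1 = τ 1 →
      (⟨t, τ, hτ⟩ : Flag Tet) = s := by
    rintro ⟨t', ρ, hρ⟩ rfl h0 h1
    obtain rfl := eq_of_even _ _ hρ hτ h0 h1
    rfl
  fin_cases i
  · exact absurd (τ.injective (h0.symm.trans hi)) (by decide)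
  · exact Or.inl (key _ rfl h0 hi)
  · exact Or.inr (Or.inl (key _ rfl h0 hi))
  · exact Or.inr (Or.inr (key _ rfl h0 hi))

theorem Flag.exists_corner_eq (x : Tet × Fin 4) {f : Fin 4} (hf : f ≠ x.2) :
    ∃ s : Flag Tet, s.corner = x ∧ s.σ 3 = f := by
  obtain ⟨t, v⟩ := x
  obtain ⟨σ, hσ, rfl, rfl⟩ := exists_even v f hf.symm
  exact ⟨Flag.rot ⟨t, σ, hσ⟩, rfl, rfl⟩

theorem front_turn_rot_rot (s : Flag Tet) : D.front (D.turn s).rot.rot = D.front s.rot :=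
  (Quot.sound ⟨s.σ 3, s.σ.injective.ne (by decide), s.σ.injective.ne (by decide), rfl⟩ :
    D.front s.rot = D.front (D.turn s).rot.rot).symm

theorem color_of_frontPi {s : Flag Tet} (h : D.FrontPi s) :
    D.color (D.front s.rot) = EdgeColor.red ∧ D.color (D.front s.rot.rot) = EdgeColor.blue := by
  obtain ⟨h1, -, -, h2⟩ := D.veering s.tet s.σ s.even h
  refine ⟨h1, ?_⟩
  rw [← D.color_rev] at h2
  exact h2

theorem frontPi_corner (s : Flag Tet) : D.FrontPi s ∨ D.FrontPi s.rot ∨ D.FrontPi s.rot.rot :=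
  D.isPi_corner s.tet s.σ

/-- The relation between the coorientations of the faces and the colours of the edges at a
corner. -/
theorem not_out_zero_iff (s : Flag Tet) : ¬ D.Out s.tet (s.σ 0) ↔ (D.Out s.tet (s.σ 3) ↔
    ¬ (D.color (D.front s) = EdgeColor.red ∧ D.color (D.front s.rot) = EdgeColor.blue)) := by
  -- The `π`-labelled edge at the corner may have either colour, but it determines the colours of
  -- the other two.
  rcases D.frontPi_corner s with h | h | h
  · have h1 := (D.color_of_frontPi h).1
    have h2 := D.out_of_isPi h
    simp only [h1, reduceCtorEq, and_false]
    tauto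
  · have h1 := (D.color_of_frontPi h).2
    rw [s.rot_rot_rot] at h1
    have h2 : (D.Out s.tet (s.σ 0) ↔ D.Out s.tet (s.σ 2)) ∧
      (D.Out s.tet (s.σ 3) ↔ D.Out s.tet (s.σ 1)) ∧
      (D.Out s.tet (s.σ 0) ↔ ¬ D.Out s.tet (s.σ 1)) := D.out_of_isPi h
    simp only [h1, reduceCtorEq, false_and]
    tauto
  · have h1 := D.color_of_frontPi h
    rw [s.rot_rot_rot] at h1
    have h2 : (D.Out s.tet (s.σ 0) ↔ D.Out s.tet (s.σ 3)) ∧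
      (D.Out s.tet (s.σ 1) ↔ D.Out s.tet (s.σ 2)) ∧
      (D.Out s.tet (s.σ 0) ↔ ¬ D.Out s.tet (s.σ 2)) := D.out_of_isPi h
    simp only [h1, and_true]
    tauto

theorem not_out_zero_iff_of_blue {s : Flag Tet} (h : D.color (D.front s) = EdgeColor.blue) :
    ¬ D.Out s.tet (s.σ 0) ↔ D.Out s.tet (s.σ 3) := by
  rw [not_out_zero_iff, h]
  simp

theorem not_out_zero_iff_of_red {s : Flag Tet} (h : D.color (D.front s) = EdgeColor.red) :
    ¬ D.Out s.tet (s.σ 0) ↔ D.Out s.tet (s.σ 2) := by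
  have := D.not_out_zero_iff s.rot.rot
  rw [s.rot_rot_rot, h] at this
  change ¬ D.Out s.tet (s.σ 0) ↔ (D.Out s.tet (s.σ 2) ↔ _) at this
  simpa only [reduceCtorEq, and_false, not_false_eq_true, iff_true] using this

/-- The two corners adjacent to an edge of the boundary triangulation have the same type if and only
if the ends of the edge have different colours. -/
theorem out_zero_turn_iff (s : Flag Tet) :
    (D.Out s.tet (s.σ 0) ↔ D.Out (D.turn s).tet ((D.turn s).σ 0)) ↔
      D.color (D.front s) ≠ D.color (D.front s.rot) := by
  have h1 := D.not_out_zero_iff s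
  have h2 := D.not_out_zero_iff (D.turn s).rot.rot
  rw [Flag.rot_rot_rot, front_turn_rot_rot, front_turn] at h2
  change ¬ D.Out (D.turn s).tet ((D.turn s).σ 0) ↔
    (D.Out (D.turn s).tet ((D.turn s).σ 2) ↔ _) at h2
  rw [D.out_turn] at h2
  generalize D.color (D.front s) = c at *
  generalize D.color (D.front s.rot) = c' at *
  cases c <;> cases c' <;> simp at h1 h2 ⊢ <;> tauto

/-- The ladderpole curve `l` passes through a vertex of the triangle of the boundary triangulation
at the corner `x`. -/
def OnCorner (x : Tet × Fin 4) (l : D.Ladderpole) : Prop :=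
  ∃ s : Flag Tet, s.corner = x ∧ pole (D.front s) = l

variable {D}

theorem onCorner_rot (s : Flag Tet) : D.OnCorner s.corner (pole (D.front s.rot)) := ⟨s.rot, rfl, rfl⟩

theorem onCorner_self (s : Flag Tet) : D.OnCorner s.corner (pole (D.front s)) := ⟨s, rfl, rfl⟩

/-- Two vertices of the same colour in a boundary triangle are joined by a side of it, which lies on
a ladderpole curve. -/
theorem OnCorner.eq {x : Tet × Fin 4} {l l' : D.Ladderpole} (h : D.OnCorner x l)
    (h' : D.OnCorner x l') (hc : l.color = l'.color) : l = l' := by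
  have key : ∀ s : Flag Tet, D.color (D.front s) = D.color (D.front s.rot) →
      pole (D.front s) = pole (D.front s.rot) :=
    fun s hs => Quot.sound ⟨s.tet, s.σ, rfl, rfl, hs⟩
  obtain ⟨s, rfl, rfl⟩ := h
  obtain ⟨s', hs, rfl⟩ := h'
  rcases Flag.eq_of_corner_eq hs.symm with rfl | rfl | rfl
  · rfl
  · exact key s hc
  · have := key s.rot.rot
    rw [s.rot_rot_rot] at this
    exact (this hc.symm).symm

theorem OnCorner.vertex_eq {x : Tet × Fin 4} {l : D.Ladderpole} (h : D.OnCorner x l) :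
    l.vertex = Quot.mk _ x := by
  obtain ⟨s, rfl, rfl⟩ := h
  rfl

variable (D)

/-- The same ladderpole curves pass through the triangles at two corners. -/
def SamePoles (x y : Tet × Fin 4) : Prop := ∀ l, D.OnCorner x l ↔ D.OnCorner y l

theorem samePoles_equivalence : Equivalence D.SamePoles :=
  ⟨fun _ _ => Iff.rfl, fun h l => (h l).symm, fun h h' l => (h l).trans (h' l)⟩

variable {D}

theorem samePoles_of_onCorner {x y : Tet × Fin 4} {l l' : D.Ladderpole} (hx : D.OnCorner x l)
    (hx' : D.OnCorner x l') (hy : D.OnCorner y l) (hy' : D.OnCorner y l')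
    (hc : l.color ≠ l'.color) : D.SamePoles x y := by
  have key : ∀ {x y : Tet × Fin 4}, D.OnCorner x l → D.OnCorner x l' → D.OnCorner y l →
      D.OnCorner y l' → ∀ m, D.OnCorner x m → D.OnCorner y m := by
    intro x y hx hx' hy hy' m hm
    by_cases h : m.color = l.color
    · rwa [hm.eq hx h]
    · rwa [hm.eq hx' (EdgeColor.eq_of_ne_of_ne h hc.symm)]
  exact fun m => ⟨key hx hx' hy hy' m, key hy hy' hx hx' m⟩

-- The common side of the two triangles is then a rung, and its ends already determine both curves.
variable (D) in
theorem samePoles_turn {s : Flag Tet}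
    (h : D.Out s.tet (s.σ 0) ↔ D.Out (D.turn s).tet ((D.turn s).σ 0)) :
    D.SamePoles s.corner (D.turn s).corner :=
  samePoles_of_onCorner (onCorner_self s) (onCorner_rot s) ⟨D.turn s, rfl, by rw [front_turn]⟩
    ⟨(D.turn s).rot.rot, rfl, by rw [front_turn_rot_rot]⟩ ((D.out_zero_turn_iff s).1 h)

theorem front_eq_of_sameCycle [Finite Tet] {s s' : Flag Tet} (h : D.turn.SameCycle s s') :
    D.front s = D.front s' := by
  obtain ⟨n, rfl⟩ := h.exists_nat_pow_eq
  induction n with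
  | zero => rfl
  | succ n ih =>
    rw [pow_succ', Equiv.Perm.mul_apply, front_turn]
    exact ih ⟨n, by simp⟩

theorem nextLeft_iff_exists {l l' : D.Ladderpole} : NextLeft l l' ↔ ∃ s : Flag Tet,
    D.Out s.tet (s.σ 3) ∧ pole (D.front s) = l ∧ pole (D.front s.rot) = l' ∧
      D.color (D.front s) ≠ D.color (D.front s.rot) := by
  constructor
  · rintro ⟨_, _, rfl, rfl, t, σ, h1, h2, rfl, rfl, h3⟩
    exact ⟨⟨t, σ, h1⟩, h2, rfl, rfl, h3⟩
  · rintro ⟨s, h1, rfl, rfl, h2⟩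
    exact ⟨_, _, rfl, rfl, s.tet, s.σ, s.even, h1, rfl, rfl, h2⟩

theorem NextLeft.exists_corner {l l' : D.Ladderpole} (h : NextLeft l l') : ∃ x : Tet × Fin 4,
    D.OnCorner x l ∧ D.OnCorner x l' ∧ (¬ D.Out x.1 x.2 ↔ l'.color = EdgeColor.red) ∧
      l.color ≠ l'.color := by
  obtain ⟨s, h1, rfl, rfl, h2⟩ := nextLeft_iff_exists.1 h
  refine ⟨s.corner, onCorner_self s, onCorner_rot s, ?_, h2⟩
  have := D.not_out_zero_iff s
  change ¬ D.Out s.tet (s.σ 0) ↔ D.color (D.front s.rot) = _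
  rw [this]
  generalize D.color (D.front s) = c at *
  generalize D.color (D.front s.rot) = c' at *
  cases c <;> cases c' <;> simp_all

/-- The triangle at each corner has an edge that joins two ladderpole curves and is cooriented
outwards. -/
theorem exists_nextLeft_corner (x : Tet × Fin 4) : ∃ l l' : D.Ladderpole, D.OnCorner x l ∧
    D.OnCorner x l' ∧ NextLeft l l' ∧ l.color ≠ l'.color ∧
      (¬ D.Out x.1 x.2 ↔ l'.color = EdgeColor.red) := by
  suffices ∃ s : Flag Tet, s.corner = x ∧ D.Out s.tet (s.σ 3) ∧
      D.color (D.front s) ≠ D.color (D.front s.rot) by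
    obtain ⟨s, rfl, h1, h2⟩ := this
    refine ⟨_, _, onCorner_self s, onCorner_rot s, nextLeft_iff_exists.2 ⟨s, h1, rfl, rfl, h2⟩,
      h2, ?_⟩
    change ¬ D.Out s.tet (s.σ 0) ↔ D.color (D.front s.rot) = _
    rw [D.not_out_zero_iff s]
    generalize D.color (D.front s) = c at *
    generalize D.color (D.front s.rot) = c' at *
    cases c <;> cases c' <;> simp_all
  obtain ⟨t, v⟩ := x
  obtain ⟨σ, hσ, rfl, hp⟩ := D.exists_isPi t v
  let s : Flag Tet := ⟨t, σ, hσ⟩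
  have hp' : D.FrontPi s := hp
  obtain ⟨h1, h2⟩ := D.color_of_frontPi hp'
  have h3 := D.out_of_isPi hp
  by_cases h : D.Out t (σ 3)
  · rcases hc : D.color (D.front s) with _ | _
    · refine ⟨s.rot.rot, rfl, h3.2.1.2 h, ?_⟩
      rw [s.rot_rot_rot, hc, h2]
      simp
    · refine ⟨s, rfl, h, ?_⟩
      rw [hc, h1]
      simp
  · refine ⟨s.rot, rfl, show D.Out t (σ 1) by tauto, ?_⟩
    rw [h1, h2]
    simp

variable [Finite Tet]

/-- Around a vertex of the boundary triangulation the type changes only at the two `π`-angles, once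
in each direction, so the triangles of one type are consecutive and are separated by rungs. -/
theorem samePoles_of_front_eq {s s' : Flag Tet} (h : D.front s = D.front s')
    (ho : D.Out s.tet (s.σ 0) ↔ D.Out s'.tet (s'.σ 0)) : D.SamePoles s.corner s'.corner := by
  refine Equiv.Perm.SameCycle.rel_of_type (f := D.turn)
    (S := fun s s' => D.SamePoles s.corner s'.corner) (T := fun s => D.Out s.tet (s.σ 0))
    ⟨fun _ => D.samePoles_equivalence.refl _, D.samePoles_equivalence.symm,
      D.samePoles_equivalence.trans⟩
    (fun s hs => D.samePoles_turn hs) ?_ (D.sameCycle_of_front_eq h) ho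
  intro a b hab hT ha hb
  have hf := front_eq_of_sameCycle hab
  -- In the order of rotation, the change comes just after a `π`-angle at a red end, and just before
  -- one at a blue end.
  rcases hc : D.color (D.front a) with _ | _
  · have key : ∀ a : Flag Tet, D.color (D.front a) = EdgeColor.red →
        ¬ (D.Out a.tet (a.σ 0) ↔ D.Out (D.turn a).tet ((D.turn a).σ 0)) →
        D.FrontPi a ∧ (D.Out a.tet (a.σ 3) ↔ ¬ D.Out a.tet (a.σ 0)) := by
      intro a hc ha
      have h1 := D.not_out_zero_iff_of_red hc
      have h2 := D.not_out_zero_iff_of_red (s := D.turn a)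
        ((congrArg D.color (D.front_turn a)).trans hc)
      have h3 := D.out_turn a
      have h4 := D.out_iff a.tet a.σ
      have taut : ∀ {p q r p' q' z : Prop}, (¬ p ↔ q) → (¬ p' ↔ q') → (q' ↔ ¬ r) →
          (¬ z → (q ↔ ¬ r)) → ¬ (p ↔ p') → z ∧ (r ↔ ¬ p) := by
        clear * -
        tauto
      exact taut h1 h2 h3 h4 ha
    obtain ⟨pa, ua⟩ := key a hc ha
    obtain ⟨pb, ub⟩ := key b (by rwa [← hf]) hb
    exact D.frontPi_unique pa pb hf (ua.trans ((not_congr hT).trans ub.symm))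
  · have key : ∀ a : Flag Tet, D.color (D.front a) = EdgeColor.blue →
        ¬ (D.Out a.tet (a.σ 0) ↔ D.Out (D.turn a).tet ((D.turn a).σ 0)) →
        D.FrontPi (D.turn a) ∧
          (D.Out (D.turn a).tet ((D.turn a).σ 3) ↔ D.Out a.tet (a.σ 0)) := by
      intro a hc ha
      have h1 := D.not_out_zero_iff_of_blue hc
      have h2 := D.not_out_zero_iff_of_blue (s := D.turn a)
        ((congrArg D.color (D.front_turn a)).trans hc)
      have h3 := D.out_turn_of_not_frontPi (s := a)
      have taut : ∀ {p r p' r' z : Prop}, (¬ p ↔ r) → (¬ p' ↔ r') → (¬ z → (r' ↔ r)) →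
          ¬ (p ↔ p') → z ∧ (r' ↔ p) := by
        clear * -
        tauto
      exact taut h1 h2 h3 ha
    obtain ⟨pa, ua⟩ := key a hc ha
    obtain ⟨pb, ub⟩ := key b (by rwa [← hf]) hb
    exact D.turn.injective (D.frontPi_unique pa pb (by rwa [front_turn, front_turn])
      (ua.trans (hT.trans ub.symm)))

theorem exists_front_eq (e : D.OEdge) (p : Prop) :
    ∃ s, D.front s = e ∧ (D.Out s.tet (s.σ 0) ↔ p) := by
  by_cases hp : p
  · obtain ⟨s, hs, h1, h2⟩ := D.exists_frontPi_not_out e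
    have := D.out_of_isPi h1
    exact ⟨s, hs, by tauto⟩
  · obtain ⟨s, hs, h1, h2⟩ := D.exists_frontPi_out e
    have := D.out_of_isPi h1
    exact ⟨s, hs, by tauto⟩

/-- A side on a ladderpole curve has triangles of both types next to it, so the one of the given
type carries the strip from one end to the other. -/
theorem samePoles_of_pole_eq {s s' : Flag Tet} (h : pole (D.front s) = pole (D.front s'))
    (ho : D.Out s.tet (s.σ 0) ↔ D.Out s'.tet (s'.σ 0)) : D.SamePoles s.corner s'.corner := by
  have step : ∀ z s s' : Flag Tet, D.color (D.front z) = D.color (D.front z.rot) →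
      D.front s = D.front z → D.front s' = D.front z.rot →
      (D.Out s.tet (s.σ 0) ↔ D.Out s'.tet (s'.σ 0)) → D.SamePoles s.corner s'.corner := by
    intro z s s' hc hs hs' ho
    by_cases hz : D.Out s.tet (s.σ 0) ↔ D.Out z.tet (z.σ 0)
    · exact D.samePoles_equivalence.trans (samePoles_of_front_eq hs hz)
        (samePoles_of_front_eq (s := z.rot) hs'.symm (hz.symm.trans ho))
    · have h1 : ¬ (D.Out z.tet (z.σ 0) ↔ D.Out (D.turn z).tet ((D.turn z).σ 0)) := by
        rw [out_zero_turn_iff]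
        exact not_not_intro hc
      exact D.samePoles_equivalence.trans
        (samePoles_of_front_eq (s' := D.turn z) (by rwa [front_turn]) (by tauto))
        (samePoles_of_front_eq (s := (D.turn z).rot.rot) (by rw [front_turn_rot_rot, hs'])
          (show D.Out (D.turn z).tet ((D.turn z).σ 0) ↔ _ by tauto))
  have key : ∀ e e' : D.OEdge, Relation.EqvGen D.PoleStep e e' → ∀ s s' : Flag Tet,
      D.front s = e → D.front s' = e' →
      (D.Out s.tet (s.σ 0) ↔ D.Out s'.tet (s'.σ 0)) → D.SamePoles s.corner s'.corner := by
    intro e e' hee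
    induction hee with
    | rel e e' h =>
      obtain ⟨t, σ, rfl, rfl, hc⟩ := h
      intro s s' hs hs' ho
      rcases Int.units_eq_one_or (Equiv.Perm.sign σ) with h | h
      · exact step ⟨t, σ, h⟩ s s' hc hs hs' ho
      · exact D.samePoles_equivalence.symm
          -- An odd labelling becomes even when the two ends of the side are exchanged.
          (step ⟨t, σ * Equiv.swap 1 2, sign_mul_swap (by decide) h⟩ s' s hc.symm hs' hs ho.symm)
    | refl e => exact fun s s' hs hs' => samePoles_of_front_eq (hs.trans hs'.symm)
    | symm e e' _ ih =>
      exact fun s s' hs hs' ho => D.samePoles_equivalence.symm (ih s' s hs' hs ho.symm)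
    | trans e e' e'' _ _ ih ih' =>
      intro s s' hs hs' ho
      obtain ⟨r, hr, hro⟩ := exists_front_eq e' (D.Out s.tet (s.σ 0))
      exact D.samePoles_equivalence.trans (ih s r hs hr hro.symm) (ih' r s' hr hs' (hro.trans ho))
  exact key _ _ (Quot.eqvGen_exact h) s s' rfl rfl ho

theorem samePoles_of_onCorner_of_out {x y : Tet × Fin 4} {l : D.Ladderpole} (hx : D.OnCorner x l)
    (hy : D.OnCorner y l) (h : ¬ D.Out x.1 x.2 ↔ ¬ D.Out y.1 y.2) : D.SamePoles x y := by
  obtain ⟨s, rfl, hs⟩ := hx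
  obtain ⟨s', rfl, hs'⟩ := hy
  exact samePoles_of_pole_eq (hs.trans hs'.symm) (not_iff_not.1 h)

/-- The colour of `l` fixes the type of the triangles on its left, and these all meet the same
curves. -/
theorem NextLeft.left_unique {l₁ l₂ l : D.Ladderpole} (h₁ : NextLeft l₁ l) (h₂ : NextLeft l₂ l) :
    l₁ = l₂ := by
  obtain ⟨x, hx, hx', hxo, hxc⟩ := h₁.exists_corner
  obtain ⟨y, hy, hy', hyo, hyc⟩ := h₂.exists_corner
  have := samePoles_of_onCorner_of_out hx' hy' (hxo.trans hyo.symm)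
  exact hx.eq ((this _).2 hy) (EdgeColor.eq_of_ne_of_ne hxc hyc)

theorem NextLeft.right_unique {l₁ l₂ l : D.Ladderpole} (h₁ : NextLeft l l₁) (h₂ : NextLeft l l₂) :
    l₁ = l₂ := by
  obtain ⟨x, hx, hx', hxo, hxc⟩ := h₁.exists_corner
  obtain ⟨y, hy, hy', hyo, hyc⟩ := h₂.exists_corner
  have hc := EdgeColor.eq_of_ne_of_ne hxc.symm hyc.symm
  have := samePoles_of_onCorner_of_out hx hy (hxo.trans (hc ▸ hyo.symm))
  exact hx'.eq ((this _).2 hy') hc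

theorem exists_onCorner (l : D.Ladderpole) (p : Prop) :
    ∃ x, D.OnCorner x l ∧ (¬ D.Out x.1 x.2 ↔ p) := by
  induction l using Quot.ind with
  | mk e =>
    obtain ⟨s, hs, h⟩ := exists_front_eq e (¬ p)
    exact ⟨s.corner, ⟨s, rfl, by rw [hs]; rfl⟩, show ¬ D.Out s.tet (s.σ 0) ↔ p by tauto⟩

theorem exists_nextLeft (l' : D.Ladderpole) : ∃ l, NextLeft l l' := by
  obtain ⟨x, hx, ho⟩ := exists_onCorner l' (l'.color = EdgeColor.red)
  obtain ⟨m, m', -, hm', h, -, ho'⟩ := D.exists_nextLeft_corner x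
  have : l' = m' := hx.eq hm' (by
    have := ho.symm.trans ho'
    generalize l'.color = c at *
    generalize m'.color = c' at *
    cases c <;> cases c' <;> simp_all)
  exact ⟨m, this ▸ h⟩

theorem exists_nextLeft_right (l : D.Ladderpole) : ∃ l', NextLeft l l' := by
  obtain ⟨x, hx, ho⟩ := exists_onCorner l (l.color = EdgeColor.blue)
  obtain ⟨m, m', hm, -, h, hc, ho'⟩ := D.exists_nextLeft_corner x
  have : l = m := hx.eq hm (by
    have := ho.symm.trans ho'
    generalize l.color = c at *
    generalize m.color = c' at *
    generalize m'.color = c'' at *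
    cases c <;> cases c' <;> cases c'' <;> simp_all)
  exact ⟨m', this ▸ h⟩

variable (D) in
/-- The ladderpole curve next on the left. -/
noncomputable def leftPole : Equiv.Perm D.Ladderpole :=
  Equiv.ofBijective (fun l => (exists_nextLeft l).choose) ⟨fun l l' h =>
    (exists_nextLeft l).choose_spec.right_unique (by
      have := (exists_nextLeft l').choose_spec
      simp only at h
      rwa [← h] at this), fun l => by
    obtain ⟨l', h⟩ := exists_nextLeft_right l
    exact ⟨l', (exists_nextLeft l').choose_spec.left_unique h⟩⟩

theorem nextLeft_leftPole (l : D.Ladderpole) : NextLeft (D.leftPole l) l :=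
  (exists_nextLeft l).choose_spec

theorem nextLeft_iff {l l' : D.Ladderpole} : NextLeft l l' ↔ l = D.leftPole l' :=
  ⟨fun h => h.left_unique (nextLeft_leftPole l'), fun h => h ▸ nextLeft_leftPole l'⟩

theorem twoLeft_iff {l l' : D.Ladderpole} : TwoLeft l l' ↔ l = D.leftPole (D.leftPole l') := by
  simp [TwoLeft, nextLeft_iff]

theorem color_leftPole (l : D.Ladderpole) : (D.leftPole l).color ≠ l.color := by
  obtain ⟨x, -, -, -, h⟩ := (nextLeft_leftPole l).exists_corner
  exact h

theorem vertex_leftPole (l : D.Ladderpole) : (D.leftPole l).vertex = l.vertex := by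
  obtain ⟨x, h, h', -⟩ := (nextLeft_leftPole l).exists_corner
  rw [h.vertex_eq, h'.vertex_eq]

theorem OnCorner.sameCycle {x : Tet × Fin 4} {l l' : D.Ladderpole} (h : D.OnCorner x l)
    (h' : D.OnCorner x l') : D.leftPole.SameCycle l l' := by
  obtain ⟨m, m', hm, hm', hl, hc, -⟩ := D.exists_nextLeft_corner x
  have h1 : D.leftPole.SameCycle m m' :=
    (show D.leftPole.SameCycle m' m from ⟨1, by simp [nextLeft_iff.1 hl]⟩).symm
  have key : ∀ l, D.OnCorner x l → D.leftPole.SameCycle l m := by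
    intro l h
    by_cases hlc : l.color = m.color
    · rw [h.eq hm hlc]
    · rw [h.eq hm' (EdgeColor.eq_of_ne_of_ne hlc hc.symm)]
      exact h1.symm
  exact (key l h).trans (key l' h').symm

/-- The ladderpole curves at a vertex are cyclically ordered. -/
theorem sameCycle_leftPole {l l' : D.Ladderpole} (h : l.vertex = l'.vertex) :
    D.leftPole.SameCycle l l' := by
  have key : ∀ x y, Relation.EqvGen D.VertexGlued x y → ∀ l l' : D.Ladderpole, D.OnCorner x l →
      D.OnCorner y l' → D.leftPole.SameCycle l l' := by
    intro x y hxy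
    induction hxy with
    | rel x y h =>
      obtain ⟨f, hf, rfl⟩ := h
      obtain ⟨s, rfl, rfl⟩ := Flag.exists_corner_eq x hf
      intro l l' hl hl'
      have h1 := hl.sameCycle (onCorner_self s)
      have h2 : D.OnCorner (D.turn s).corner (pole (D.front s)) := ⟨D.turn s, rfl, by rw [front_turn]⟩
      exact h1.trans (h2.sameCycle hl')
    | refl x => exact fun l l' h h' => h.sameCycle h'
    | symm x y _ ih => exact fun l l' h h' => (ih l' l h' h).symm
    | trans x y z _ _ ih ih' =>
      intro l l' h h'
      obtain ⟨m, -, hm, -⟩ := D.exists_nextLeft_corner y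
      exact (ih l m h hm).trans (ih' m l' hm h')
  obtain ⟨x, hx, -⟩ := exists_onCorner l True
  obtain ⟨y, hy, -⟩ := exists_onCorner l' True
  rw [hx.vertex_eq, hy.vertex_eq] at h
  exact key x y (Quot.eqvGen_exact h) l l' hx hy

end VeeringTriangulation

/-! ### Connectivity by red edges, and the number of edges -/

namespace VeeringTriangulation

open TransverseTautTriangulation

variable {Tet : Type*} {D : VeeringTriangulation Tet}

theorem rev_rev (e : D.OEdge) : e.rev.rev = e := by
  induction e using Quot.ind with
  | mk x => rfl

variable (D) in
/-- Two vertices are joined by a path of red edges. -/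
def RedJoined : D.Vert → D.Vert → Prop :=
  Relation.EqvGen fun T T' => ∃ e : D.OEdge, D.color e = EdgeColor.red ∧ e.source = T ∧ e.target = T'

theorem RedJoined.trans {T T' T'' : D.Vert} (h : D.RedJoined T T') (h' : D.RedJoined T' T'') :
    D.RedJoined T T'' := Relation.EqvGen.trans _ _ _ h h'

theorem RedJoined.symm {T T' : D.Vert} (h : D.RedJoined T T') : D.RedJoined T' T :=
  Relation.EqvGen.symm _ _ h

variable (D) in
/-- The ideal vertex at a corner. -/
def vertexAt (t : Tet) (i : Fin 4) : D.Vert := Quot.mk _ (t, i)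

theorem vertexAt_glue (t : Tet) {f i : Fin 4} (h : i ≠ f) :
    D.vertexAt (D.glueTet t f) (D.glueMap t f i) = D.vertexAt t i :=
  (Quot.sound ⟨f, h.symm, rfl⟩ : D.vertexAt t i = _).symm

/-- Of the two `0`-labelled edges at a corner, one is red. -/
theorem exists_redJoined_ne (t : Tet) (i : Fin 4) :
    ∃ j, j ≠ i ∧ D.RedJoined (D.vertexAt t i) (D.vertexAt t j) := by
  obtain ⟨σ, hσ, rfl, hp⟩ := D.exists_isPi t i
  exact ⟨σ 2, σ.injective.ne (by decide), Relation.EqvGen.rel _ _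
    ⟨D.edgeAt t σ 0 2, (D.color_of_frontPi (s := ⟨t, σ, hσ⟩) hp).1, rfl, rfl⟩⟩

/-- If the vertices of a face of a tetrahedron are joined by red edges, then so are all vertices. -/
theorem redJoined_of_face {t : Tet} {f : Fin 4}
    (h : ∀ i j, i ≠ f → j ≠ f → D.RedJoined (D.vertexAt t i) (D.vertexAt t j)) (i j : Fin 4) :
    D.RedJoined (D.vertexAt t i) (D.vertexAt t j) := by
  have key : ∀ i, ∃ i', i' ≠ f ∧ D.RedJoined (D.vertexAt t i) (D.vertexAt t i') := by
    intro i
    by_cases hi : i = f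
    · subst hi
      exact exists_redJoined_ne t i
    · exact ⟨i, hi, Relation.EqvGen.refl _⟩
  obtain ⟨i', hi, hi'⟩ := key i
  obtain ⟨j', hj, hj'⟩ := key j
  exact hi'.trans ((h i' j' hi hj).trans hj'.symm)

theorem redJoined_glue_iff (t : Tet) (f : Fin 4) :
    (∀ i j, D.RedJoined (D.vertexAt t i) (D.vertexAt t j)) ↔
      ∀ i j, D.RedJoined (D.vertexAt (D.glueTet t f) i) (D.vertexAt (D.glueTet t f) j) := by
  constructor
  · intro h
    refine redJoined_of_face (f := D.glueMap t f f) fun i j hi hj => ?_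
    obtain ⟨i, rfl⟩ := (D.glueMap t f).surjective i
    obtain ⟨j, rfl⟩ := (D.glueMap t f).surjective j
    rw [vertexAt_glue t fun h => hi (congrArg _ h), vertexAt_glue t fun h => hj (congrArg _ h)]
    exact h i j
  · intro h
    refine redJoined_of_face (f := f) fun i j hi hj => ?_
    rw [← vertexAt_glue t hi, ← vertexAt_glue t hj]
    exact h _ _

theorem exists_red [Nonempty Tet] : ∃ e : D.OEdge, D.color e = EdgeColor.red := by
  obtain ⟨t⟩ := ‹Nonempty Tet›
  obtain ⟨σ, hσ, -, hp⟩ := D.exists_isPi t 0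
  exact ⟨_, (D.color_of_frontPi (s := ⟨t, σ, hσ⟩) hp).1⟩

/-- The red edges connect all vertices. -/
theorem redJoined [Nonempty Tet] (hD : D.Connected) (T T' : D.Vert) : D.RedJoined T T' := by
  have hglue : ∀ s t, Relation.EqvGen (fun x y : Tet => ∃ f, y = D.glueTet x f) s t →
      ((∀ i j, D.RedJoined (D.vertexAt s i) (D.vertexAt s j)) ↔
        ∀ i j, D.RedJoined (D.vertexAt t i) (D.vertexAt t j)) := by
    intro s t h
    induction h with
    | rel s t h =>
      obtain ⟨f, rfl⟩ := h
      exact redJoined_glue_iff s f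
    | refl s => exact Iff.rfl
    | symm s t _ ih => exact ih.symm
    | trans s t u _ _ ih ih' => exact ih.trans ih'
  have htet : ∀ t i j, D.RedJoined (D.vertexAt t i) (D.vertexAt t j) := by
    -- In a tetrahedron with a red `π`-labelled edge from `σ 0` to `σ 1`, the path `σ 2, σ 0, σ 1, σ
    -- 3` is red. From there the property spreads through the gluings.
    obtain ⟨e, he⟩ := D.exists_red
    obtain ⟨s, rfl, hp⟩ := D.exists_frontPi e
    intro t
    refine (hglue s.tet t (hD _ _)).1 fun i j => ?_
    have h01 : D.RedJoined (D.vertexAt s.tet (s.σ 0)) (D.vertexAt s.tet (s.σ 1)) :=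
      Relation.EqvGen.rel _ _ ⟨_, he, rfl, rfl⟩
    have h02 : D.RedJoined (D.vertexAt s.tet (s.σ 0)) (D.vertexAt s.tet (s.σ 2)) :=
      Relation.EqvGen.rel _ _ ⟨_, (D.color_of_frontPi hp).1, rfl, rfl⟩
    have h13 : D.RedJoined (D.vertexAt s.tet (s.σ 1)) (D.vertexAt s.tet (s.σ 3)) :=
      Relation.EqvGen.rel _ _ ⟨_, (D.veering s.tet s.σ s.even hp).2.2.1, rfl, rfl⟩
    have key : ∀ i, D.RedJoined (D.vertexAt s.tet (s.σ 0)) (D.vertexAt s.tet (s.σ i)) := by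
      intro i
      fin_cases i
      · exact Relation.EqvGen.refl _
      · exact h01
      · exact h02
      · exact h01.trans h13
    obtain ⟨i, rfl⟩ := s.σ.surjective i
    obtain ⟨j, rfl⟩ := s.σ.surjective j
    exact (key i).symm.trans (key j)
  have hall : ∀ s t, Relation.EqvGen (fun x y : Tet => ∃ f, y = D.glueTet x f) s t →
      ∀ i j, D.RedJoined (D.vertexAt s i) (D.vertexAt t j) := by
    intro s t h
    induction h with
    | rel s t h =>
      obtain ⟨f, rfl⟩ := h
      intro i j
      obtain ⟨g, hg⟩ := exists_ne f
      refine (htet s i g).trans ?_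
      rw [← vertexAt_glue s hg]
      exact htet _ _ _
    | refl s => exact htet s
    | symm s t _ ih => exact fun i j => (ih j i).symm
    | trans s t u _ _ ih ih' => exact fun i j => (ih i 0).trans (ih' 0 j)
  induction T using Quot.ind with
  | mk x =>
    induction T' using Quot.ind with
    | mk y => exact hall x.1 y.1 (hD _ _) x.2 y.2

/-- There are at most as many edges as tetrahedra. -/
theorem exists_edge_of_tet [Finite Tet] (D : VeeringTriangulation Tet) :
    ∃ b : Tet → D.OEdge, ∀ e, ∃ t, b t = e ∨ (b t).rev = e := by
  -- Assign to `t` its top edge, the `π`-labelled edge whose two adjacent faces are cooriented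
  -- outwards. Every edge is the top edge of some tetrahedron by `exists_frontPi_out`.
  have h : ∀ t, ∃ σ : Equiv.Perm (Fin 4), D.IsPi t (σ 0) (σ 1) ∧ D.Out t (σ 3) := by
    intro t
    obtain ⟨σ, -, -, hp⟩ := D.exists_isPi t 0
    have hp' : D.IsPi t (σ 2) (σ 3) := (D.isPi_iff_of_isPi hp _ _).2 (Or.inr rfl)
    have := D.out_of_isPi hp
    by_cases ho : D.Out t (σ 3)
    · exact ⟨σ, hp, ho⟩
    · exact ⟨σ * (Equiv.swap 0 2 * Equiv.swap 1 3), hp', show D.Out t (σ 1) by tauto⟩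
  choose τ hτ hτo using h
  refine ⟨fun t => D.edgeAt t (τ t) 0 1, fun e => ?_⟩
  obtain ⟨s, rfl, hp, ho⟩ := D.exists_frontPi_out e
  refine ⟨s.tet, ?_⟩
  have h1 := D.out_of_isPi hp
  have h2 := D.out_of_isPi (hτ s.tet)
  have h3 := hτo s.tet
  have h4 : ¬ D.Out s.tet (s.σ 0) := fun h => h1.2.2.1 h ho
  rcases (D.isPi_iff_of_isPi (hτ s.tet) _ _).1 hp with h | h <;> rw [Sym2.eq_iff] at h
  · rcases h with ⟨ha, hb⟩ | ⟨ha, hb⟩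
    · left
      simp only [IdealTriangulation.edgeAt, front_eq_edgeAt, ha, hb]
    · right
      change D.edge s.tet (τ s.tet 1) (τ s.tet 0) _ = _
      simp only [IdealTriangulation.edgeAt, front_eq_edgeAt, ha, hb]
  · exfalso
    rcases h with ⟨ha, -⟩ | ⟨ha, -⟩ <;> rw [ha] at h4
    · exact h4 (h2.2.1.2 h3)
    · exact h4 h3

/-- A family of red edges in which every red edge occurs at least `c` times. -/
theorem exists_red_family [Finite Tet] (D : VeeringTriangulation Tet) (c : ℕ) :
    ∃ (k : ℕ) (d' : Fin k → D.OEdge), k ≤ c * Nat.card Tet ∧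
      (∀ j, D.color (d' j) = EdgeColor.red) ∧ ∀ e, D.color e = EdgeColor.red →
        c ≤ Nat.card {j // d' j = e ∨ (d' j).rev = e} := by
  obtain ⟨b, hb⟩ := exists_edge_of_tet D
  let J := {t // D.color (b t) = EdgeColor.red} × Fin c
  let φ : Fin (Nat.card J) ≃ J := (Finite.equivFin J).symm
  refine ⟨Nat.card J, fun j => b (φ j).1.1, ?_, fun j => (φ j).1.2, fun e he => ?_⟩
  · rw [Nat.card_prod, Nat.card_fin, mul_comm]
    exact Nat.mul_le_mul_left _ (Finite.card_subtype_le _)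
  · obtain ⟨t, ht⟩ := hb e
    have hc : D.color (b t) = EdgeColor.red := by
      rcases ht with rfl | rfl
      · exact he
      · rwa [D.color_rev] at he
    have := Nat.card_le_card_of_injective
      (fun i : Fin c => (⟨φ.symm (⟨t, hc⟩, i), by simpa using ht⟩ :
        {j // b (φ j).1.1 = e ∨ (b (φ j).1.1).rev = e})) (fun i i' h =>
        congrArg Prod.snd (φ.symm.injective (congrArg Subtype.val h)))
    rwa [Nat.card_fin] at this

/-! ### Red ladderpole curves and the construction of the sequence -/

variable (D) in
/-- The red ladderpole curves. -/
abbrev RedPole : Type _ := {l : D.Ladderpole // l.color = EdgeColor.red}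

theorem exists_redPole (T : D.Vert) : ∃ r : D.RedPole, r.1.vertex = T := by
  induction T using Quot.ind with
  | mk x =>
    obtain ⟨l, l', h, h', -, hc, -⟩ := D.exists_nextLeft_corner x
    by_cases hl : l.color = EdgeColor.red
    · exact ⟨⟨l, hl⟩, h.vertex_eq⟩
    · exact ⟨⟨l', by
        have := EdgeColor.ne_red.1 hl
        exact EdgeColor.eq_of_ne_of_ne (this ▸ hc.symm) (by simp)⟩, h'.vertex_eq⟩

section Finite

variable [Finite Tet]

instance : Finite D.OEdge := Finite.of_surjective _ D.front_surjective

instance : Finite D.Ladderpole := inferInstanceAs (Finite (Quot _))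

instance : Finite D.Vert := inferInstanceAs (Finite (Quot _))

theorem color_leftPole_eq_blue {l : D.Ladderpole} (h : l.color = EdgeColor.red) :
    (D.leftPole l).color = EdgeColor.blue :=
  EdgeColor.ne_red.1 (h ▸ color_leftPole l)

theorem color_leftPole_leftPole (l : D.Ladderpole) :
    (D.leftPole (D.leftPole l)).color = l.color :=
  EdgeColor.eq_of_ne_of_ne (color_leftPole _) (color_leftPole l).symm

variable (D) in
/-- The red ladderpole curve next on the left to a red one. -/
noncomputable def leftRed : Equiv.Perm D.RedPole :=
  (D.leftPole * D.leftPole).subtypePerm fun l => by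
    rw [Equiv.Perm.mul_apply, color_leftPole_leftPole]

theorem leftRed_coe (r : D.RedPole) : (D.leftRed r : D.Ladderpole) = D.leftPole (D.leftPole r) := rfl

theorem vertex_leftRed (r : D.RedPole) : (D.leftRed r).1.vertex = r.1.vertex := by
  rw [leftRed_coe, vertex_leftPole, vertex_leftPole]

/-- Colours alternate, so the number of left steps between two red curves is even. -/
theorem sameCycle_leftRed {r r' : D.RedPole} (h : r.1.vertex = r'.1.vertex) :
    D.leftRed.SameCycle r r' := by
  obtain ⟨n, hn⟩ := (sameCycle_leftPole h).exists_nat_pow_eq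
  have key : ∀ m : ℕ, (((D.leftRed ^ m) r : D.RedPole) : D.Ladderpole) = (D.leftPole ^ (m + m)) r := by
    intro m
    induction m with
    | zero => rfl
    | succ m ih =>
      rw [pow_succ', Equiv.Perm.mul_apply, leftRed_coe, ih, show m + 1 + (m + 1) = m + m + 1 + 1 by omega,
        pow_succ', pow_succ']
      rfl
  rcases Nat.even_or_odd' n with ⟨m, rfl | rfl⟩
  · refine ⟨m, Subtype.ext ?_⟩
    rw [zpow_natCast, key, ← two_mul, hn]
  · rw [pow_succ', two_mul, Equiv.Perm.mul_apply, ← key] at hn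
    have := color_leftPole_eq_blue ((D.leftRed ^ m) r).2
    rw [hn, r'.2] at this
    simp at this

/-- The two red curves and their left neighbours, which are blue, are four curves at one vertex. -/
theorem two_le_maxLadderpoleMultiplicity {r r' : D.RedPole} (hne : r ≠ r')
    (h : r.1.vertex = r'.1.vertex) : 2 ≤ D.maxLadderpoleMultiplicity := by
  have hinj : Function.Injective (![⟨r, h⟩, ⟨r', rfl⟩, ⟨D.leftPole r, by rw [vertex_leftPole, h]⟩,
      ⟨D.leftPole r', by rw [vertex_leftPole]⟩] :
      Fin 4 → {l : D.Ladderpole // l.vertex = r'.1.vertex}) := by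
    have h1 : r.1 ≠ r'.1 := fun h => hne (Subtype.ext h)
    have h2 : ∀ a b : D.RedPole, a.1 ≠ D.leftPole b.1 := by
      intro a b hab
      have := color_leftPole_eq_blue b.2
      rw [← hab, a.2] at this
      simp at this
    have h3 : D.leftPole r.1 ≠ D.leftPole r'.1 := D.leftPole.injective.ne h1
    intro i j hij
    fin_cases i <;> fin_cases j <;> first
      | rfl
      | exact absurd (congrArg Subtype.val hij) h1
      | exact absurd (congrArg Subtype.val hij) h1.symm
      | exact absurd (congrArg Subtype.val hij) (h2 _ _)
      | exact absurd (congrArg Subtype.val hij) (h2 _ _).symm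
      | exact absurd (congrArg Subtype.val hij) h3
      | exact absurd (congrArg Subtype.val hij) h3.symm
  have h4 := Nat.card_le_card_of_injective _ hinj
  rw [Nat.card_fin] at h4
  have h5 : 2 ≤ D.ladderpoleMultiplicity r'.1.vertex := by
    unfold ladderpoleMultiplicity
    omega
  exact h5.trans (le_ciSup (Set.finite_range D.ladderpoleMultiplicity).bddAbove _)

/-- Red edges in which every red edge occurs often enough, together with an admissible collection
can be arranged in a red edge sequence with given minimal crossing numbers. -/
theorem exists_redEdgeSequence [Nonempty Tet] (hD : D.Connected) {M k c : ℕ} {d : Fin M → D.OEdge}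
    (hd : RedAdmissible d) {α : D.Vert → ℕ} (hα : ∀ T, 1 ≤ α T) {d' : Fin k → D.OEdge}
    (hd' : ∀ j, D.color (d' j) = EdgeColor.red)
    (hc : ∀ T, α T + (if 2 ≤ D.maxLadderpoleMultiplicity then M else 0) < c)
    (hmany : ∀ e, D.color e = EdgeColor.red → c ≤ Nat.card {j // d' j = e ∨ (d' j).rev = e}) :
    ∃ S : D.RedEdgeSequence (M + 2 * k), S.Arranges d d' ∧ ∀ T : D.Vert, IsLeast
      {m : ℕ | ∃ l : D.Ladderpole,
        l.vertex = T ∧ l.color = EdgeColor.blue ∧ m = S.crossings l} (α T) := by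
  classical
  let E := Fin M ⊕ (Fin k ⊕ Fin k)
  let G : E → D.OEdge := Sum.elim d (Sum.elim d' fun j => (d' j).rev)
  have hG : ∀ e, D.color (G e) = EdgeColor.red := by
    rintro (i | j | j)
    · exact hd.1 i
    · exact hd' j
    · exact (D.color_rev _).trans (hd' j)
  let inn : E → D.RedPole := fun e => ⟨pole (G e).rev, (D.color_rev _).trans (hG e)⟩
  let out : E → D.RedPole := fun e => ⟨pole (G e), hG e⟩
  obtain ⟨h, hM, hflow⟩ := exists_flow D.leftRed (fun r => r.1.vertex)
    (fun _ _ => sameCycle_leftRed) (fun i => inn (Sum.inl i)) (fun i => out (Sum.inl i)) hd.2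
  have hmin : ∀ T, ∃ r : D.RedPole, r.1.vertex = T ∧ ∀ r' : D.RedPole, r'.1.vertex = T → h r ≤ h r' :=
    fun T => Set.exists_min_image {r : D.RedPole | r.1.vertex = T} h (Set.toFinite _) (exists_redPole T)
  choose b hbT hb using hmin
  -- Adding a constant at each vertex preserves the balance, so the minimum, attained at `b T`, can
  -- be moved to `α T`. The subtraction is never truncated, by the choice of `b`.
  let x : D.RedPole → ℕ := fun r => h r - h (b r.1.vertex) + α r.1.vertex
  have hbal : ∀ r, Nat.card {e // inn e = D.leftRed r} + x r =
      Nat.card {e // out e = D.leftRed r} + x (D.leftRed r) := by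
    intro r
    have h1 := hflow r
    have h2 := hb _ r rfl
    have h3 := hb _ (D.leftRed r) (vertex_leftRed r)
    -- Each `d' j` arrives where its reverse departs and conversely, so these edges cancel in the
    -- balance.
    have h4 : ∀ j, inn (Sum.inr (Sum.inr j)) = out (Sum.inr (Sum.inl j)) := fun j =>
      Subtype.ext (congrArg pole (rev_rev (d' j)))
    have h5 : ∀ j, inn (Sum.inr (Sum.inl j)) = out (Sum.inr (Sum.inr j)) := fun j => rfl
    have h6 : ∀ p : E → Prop, Nat.card {e // p e} = Nat.card {i // p (Sum.inl i)} +
        (Nat.card {j // p (Sum.inr (Sum.inl j))} + Nat.card {j // p (Sum.inr (Sum.inr j))}) :=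
      fun p => (Nat.card_subtype_sum p).trans (congrArg _ (Nat.card_subtype_sum _))
    rw [h6, h6]
    simp only [h4, h5, x, vertex_leftRed]
    omega
  have hlt : ∀ r, x r < Nat.card {e // inn e = r} := by
    intro r
    have h1 : c ≤ Nat.card {e // inn e = r} := by
      obtain ⟨l, hl⟩ := r
      induction l using Quot.ind with
      | mk e =>
        refine (hmany e hl).trans ?_
        -- Every copy of the edge `e`, which starts on `r`, yields an arrival at `r`, through `d' j`
        -- or through its reverse.
        refine Nat.card_le_card_of_injective (fun j => if hj : (d' j.1).rev = e then
          ⟨Sum.inr (Sum.inl j.1), Subtype.ext (congrArg pole hj)⟩ else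
          ⟨Sum.inr (Sum.inr j.1), Subtype.ext (congrArg pole
            ((rev_rev _).trans (j.2.resolve_right hj)))⟩) ?_
        intro j j' hj
        beta_reduce at hj
        split_ifs at hj <;> have hj' := congrArg Subtype.val hj
        · exact Subtype.ext (Sum.inl_injective (Sum.inr_injective hj'))
        · exact absurd (Sum.inr_injective hj') Sum.inl_ne_inr
        · exact absurd (Sum.inr_injective hj') Sum.inr_ne_inl
        · exact Subtype.ext (Sum.inr_injective (Sum.inr_injective hj'))
    refine lt_of_lt_of_le (lt_of_le_of_lt ?_ (hc r.1.vertex)) h1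
    change h r - h (b r.1.vertex) + α r.1.vertex ≤ _
    rw [add_comm]
    refine Nat.add_le_add_left ?_ _
    split_ifs with hν
    · exact (Nat.sub_le _ _).trans (hM r)
    -- With a single red curve at each vertex the flow equals its minimum, and `x` is just `α`.
    · have : b r.1.vertex = r := by
        by_contra hne
        exact hν (two_le_maxLadderpoleMultiplicity hne (hbT _))
      rw [this, Nat.sub_self]
  have hconn : ∀ r r', Relation.EqvGen
      (fun a b => b = D.leftRed a ∨ ∃ e, a = out e ∧ b = inn e) r r' := by
    have hsame : ∀ r r' : D.RedPole, r.1.vertex = r'.1.vertex → Relation.EqvGen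
        (fun a b => b = D.leftRed a ∨ ∃ e, a = out e ∧ b = inn e) r r' := by
      intro r r' hr
      obtain ⟨n, rfl⟩ := (sameCycle_leftRed hr).exists_nat_pow_eq
      clear hr
      induction n with
      | zero => exact Relation.EqvGen.refl _
      | succ n ih =>
        rw [pow_succ', Equiv.Perm.mul_apply]
        exact Relation.EqvGen.trans _ _ _ ih (Relation.EqvGen.rel _ _ (Or.inl rfl))
    have hjoin : ∀ T T', D.RedJoined T T' → ∀ r r' : D.RedPole, r.1.vertex = T → r'.1.vertex = T' →
        Relation.EqvGen (fun a b => b = D.leftRed a ∨ ∃ e, a = out e ∧ b = inn e) r r' := by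
      intro T T' hT
      induction hT with
      | rel T T' hT =>
        obtain ⟨e, he, rfl, rfl⟩ := hT
        intro r r' hr hr'
        have : Nonempty {j // d' j = e ∨ (d' j).rev = e} := by
          have h1 := hmany e he
          have h2 := hc e.source
          exact (Nat.card_pos_iff.1 (by omega)).1
        obtain ⟨j, hj⟩ := this.some
        obtain ⟨a, rfl⟩ : ∃ a, G a = e := by
          rcases hj with hj | hj
          · exact ⟨Sum.inr (Sum.inl j), hj⟩
          · exact ⟨Sum.inr (Sum.inr j), hj⟩
        exact Relation.EqvGen.trans _ _ _ (hsame r (out a) hr)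
          (Relation.EqvGen.trans _ _ _ (Relation.EqvGen.rel _ _ (Or.inr ⟨a, rfl, rfl⟩))
            (hsame (inn a) r' hr'.symm))
      | refl T => exact fun r r' hr hr' => hsame r r' (hr.trans hr'.symm)
      | symm T T' _ ih => exact fun r r' hr hr' => Relation.EqvGen.symm _ _ (ih r' r hr' hr)
      | trans T T' T'' _ _ ih ih' =>
        exact fun r r' hr hr' => Relation.EqvGen.trans _ _ _ (ih r (b T') hr (hbT _))
          (ih' (b T') r' (hbT _) hr')
    exact fun r r' => hjoin _ _ (redJoined hD _ _) r r' rfl rfl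
  obtain ⟨s, cr, hs, hcyc⟩ := exists_cyclic_arrangement hbal
    (fun r => Nat.add_pos_right _ (hα _)) hlt hconn
  obtain ⟨φ, hφ⟩ := Equiv.Perm.exists_equiv_finRotate (P := M + 2 * k)
    (by simp only [E, Nat.card_sum, Nat.card_fin]; omega) hcyc
  -- If all arrivals crossed, their number at a curve would be `x r`, against the strict inequality.
  have hstay : ∃ e, ¬ cr e := by
    by_contra! hno
    obtain ⟨r, -⟩ := exists_redPole (D.vertexAt (Classical.arbitrary Tet) 0)
    have h1 := hs.2.2 r
    rw [Nat.card_congr (Equiv.subtypeEquivRight fun e =>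
      ⟨And.left, fun he : inn e = r => ⟨he, hno e⟩⟩)] at h1
    exact (hlt r).ne h1.symm
  let S : D.RedEdgeSequence (M + 2 * k) :=
    { edge := fun i => G (φ i)
      vert := fun i => (G (φ i)).target
      cross := fun i => cr (φ i)
      color_edge := fun i => hG _
      target_edge := fun i => rfl
      source_edge := fun i => by
        rw [hφ]
        change (out (s (φ i))).1.vertex = (inn (φ i)).1.vertex
        by_cases hcr : cr (φ i)
        · rw [hs.2.1 _ hcr, vertex_leftRed]
        · rw [hs.1 _ hcr]
      same_of_not_cross := fun i hi => by
        rw [hφ]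
        exact congrArg Subtype.val (hs.1 _ hi)
      left_of_cross := fun i hi => by
        rw [hφ, twoLeft_iff]
        exact congrArg Subtype.val (hs.2.1 _ hi)
      exists_not_cross := ⟨φ.symm hstay.choose, by
        rw [φ.apply_symm_apply]
        exact hstay.choose_spec⟩ }
  have hcross : ∀ r : D.RedPole, S.crossings (D.leftPole r.1) = x r := by
    intro r
    rw [← hs.2.2 r]
    refine Nat.card_congr (φ.subtypeEquiv fun i => ?_)
    rw [nextLeft_iff, D.leftPole.injective.eq_iff, and_comm, eq_comm, Subtype.ext_iff]
  refine ⟨S, ?_, fun T => ⟨⟨D.leftPole (b T).1, ?_, color_leftPole_eq_blue (b T).2, ?_⟩, ?_⟩⟩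
  · rw [RedEdgeSequence.Arranges, ← Multiset.coe_eq_coe]
    simp only [← Multiset.coe_add, ← Fin.univ_val_map]
    have h1 : Multiset.map S.edge Finset.univ.val = Multiset.map G Finset.univ.val := by
      change Multiset.map (fun i => G (φ i)) _ = _
      rw [← Multiset.map_univ_val_equiv φ, Multiset.map_map]
      rfl
    rw [h1, ← Finset.univ_disjSum_univ, ← Finset.univ_disjSum_univ]
    simp [Finset.disjSum, Multiset.disjSum, G, Function.comp_def]
  · rw [vertex_leftPole, hbT]
  · rw [hcross]
    simp [x, hbT]
  · rintro m ⟨l, hl, hlc, rfl⟩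
    obtain ⟨l, rfl⟩ := D.leftPole.surjective l
    rw [vertex_leftPole] at hl
    have hlr : l.color = EdgeColor.red := EdgeColor.eq_of_ne_of_ne
      (hlc ▸ (color_leftPole l).symm) (by simp)
    rw [hcross ⟨l, hlr⟩]
    simp [x, hl]

end Finite

end VeeringTriangulation

/-! ### The theorem and the bound on `k` -/

theorem mainTheorem7 {Tet : Type*} [Finite Tet] [Nonempty Tet] (D : VeeringTriangulation Tet)
    (hD : D.Connected) (M : ℕ) (d : Fin M → D.OEdge)
    (hd : VeeringTriangulation.RedAdmissible d) :
    (∃ (k : ℕ) (d' : Fin k → D.OEdge) (S : D.RedEdgeSequence (M + 2 * k)),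
      (∀ j, D.color (d' j) = EdgeColor.red) ∧ S.Arranges d d') ∧
    ∀ α : D.Vert → ℕ, (∀ T, 1 ≤ α T) →
      ∃ (k : ℕ) (d' : Fin k → D.OEdge) (S : D.RedEdgeSequence (M + 2 * k)),
        (∀ j, D.color (d' j) = EdgeColor.red) ∧ S.Arranges d d' ∧
        (∀ T : D.Vert, IsLeast
          {m : ℕ | ∃ l : D.Ladderpole,
            l.vertex = T ∧ l.color = EdgeColor.blue ∧ m = S.crossings l} (α T)) ∧
        (k : ℚ) ≤ ((D.maxLadderpoleMultiplicity : ℚ) / 2 * (M : ℚ) + ((⨆ T, α T : ℕ) : ℚ) + 1)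
          * (Nat.card Tet : ℚ) + (M : ℚ) := by
  have key : ∀ α : D.Vert → ℕ, (∀ T, 1 ≤ α T) →
      ∃ (k : ℕ) (d' : Fin k → D.OEdge) (S : D.RedEdgeSequence (M + 2 * k)),
        (∀ j, D.color (d' j) = EdgeColor.red) ∧ S.Arranges d d' ∧
        (∀ T : D.Vert, IsLeast
          {m : ℕ | ∃ l : D.Ladderpole,
            l.vertex = T ∧ l.color = EdgeColor.blue ∧ m = S.crossings l} (α T)) ∧
        (k : ℚ) ≤ ((D.maxLadderpoleMultiplicity : ℚ) / 2 * (M : ℚ) + ((⨆ T, α T : ℕ) : ℚ) + 1)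
          * (Nat.card Tet : ℚ) + (M : ℚ) := by
    intro α hα
    obtain ⟨k, d', hk, hd', hmany⟩ := VeeringTriangulation.exists_red_family D
      -- The flow above its minimum is at most `M`, and zero if `ν < 2`; the `1` leaves room for a
      -- non-crossing arrival at each curve. The case distinction is what allows `M` to be bounded
      -- by `ν / 2 * M`.
      ((⨆ T, α T) + (if 2 ≤ D.maxLadderpoleMultiplicity then M else 0) + 1)
    obtain ⟨S, hS, hS'⟩ := VeeringTriangulation.exists_redEdgeSequence hD hd hα hd' (fun T => by
      have : α T ≤ ⨆ T, α T := le_ciSup (Set.finite_range α).bddAbove T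
      omega) hmany
    refine ⟨k, d', S, hd', hS, hS', ?_⟩
    have h1 : (k : ℚ) ≤ (((⨆ T, α T : ℕ) : ℚ) +
        ((if 2 ≤ D.maxLadderpoleMultiplicity then M else 0 : ℕ) : ℚ) + 1) * (Nat.card Tet : ℚ) := by
      exact_mod_cast hk
    have h2 : ((if 2 ≤ D.maxLadderpoleMultiplicity then M else 0 : ℕ) : ℚ) ≤
        (D.maxLadderpoleMultiplicity : ℚ) / 2 * (M : ℚ) := by
      split_ifs with hν
      · have : (2 : ℚ) ≤ D.maxLadderpoleMultiplicity := by exact_mod_cast hν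
        exact le_mul_of_one_le_left (Nat.cast_nonneg _) (by linarith)
      · rw [Nat.cast_zero]
        positivity
    have h3 : (0 : ℚ) ≤ M := Nat.cast_nonneg _
    refine h1.trans (le_add_of_le_of_nonneg (mul_le_mul_of_nonneg_right ?_ (Nat.cast_nonneg _)) h3)
    linarith
  refine ⟨?_, key⟩
  obtain ⟨k, d', S, h1, h2, -⟩ := key (fun _ => 1) fun _ => le_rfl
  exact ⟨k, d', S, h1, h2⟩
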